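/- Let $\kappa$ be a regular cardinal. Colimits over $\kappa$-directed posets (equivalently, over small $\kappa$-filtered categories) are called $\kappa$-directed colimits. For an additive category $\mathsf A$, let $\mathbf C^3(\mathsf A)$ be the category of three-term complexes $A^1\to A^2\to A^3$ in $\mathsf A$ (composable pairs of morphisms with zero composition), and let $\mathsf A_{<\kappa}\subset\mathsf A$ be the full subcategory of $\kappa$-presentable objects. Exact structures are understood in the sense of Quillen. An exact structure on a $\kappa$-accessible additive category $\mathsf A$ is called *locally $\kappa$-coherent* if its admissible short exact sequences are precisely the $\kappa$-directed colimits, taken in $\mathbf C^3(\mathsf A)$, of those admissible short exact sequences in $\mathsf A$ whose three terms belong to $\mathsf A_{<\kappa}$. (a) Let $\mathsf A$ be a $\kappa$-accessible additive category. For any locally $\kappa$-coherent exact structure on $\mathsf A$, the full subcategory $\mathsf A_{<\kappa}$ is closed under extensions in $\mathsf A$, and so it inherits an exact structure, in which a three-term complex in $\mathsf A_{<\kappa}$ is a short exact sequence if and only if it is one in $\mathsf A$. For any exact structure on $\mathsf A_{<\kappa}$, the class of all $\kappa$-directed colimits in $\mathbf C^3(\mathsf A)$ of short exact sequences in $\mathsf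 A_{<\kappa}$ is a locally $\kappa$-coherent exact structure on $\mathsf A$. These two assignments are mutually inverse bijections between the locally $\kappa$-coherent exact structures on $\mathsf A$ and the exact structures on $\mathsf A_{<\kappa}$. (b) Let $\mathsf S$ be a small additive category with an exact structure. Then the category $\operatorname{Ind}_{(\kappa)}\mathsf S$ of ind-objects representable by $\kappa$-directed diagrams of objects of $\mathsf S$ is a $\kappa$-accessible additive category, and there exists a unique locally $\kappa$-coherent exact structure on $\operatorname{Ind}_{(\kappa)}\mathsf S$ such that (the essential image of) $\mathsf S$ is closed under extensions in $\operatorname{Ind}_{(\kappa)}\mathsf S$ and the exact structure inherited by $\mathsf S$ is the given one. -/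

import Mathlib

open CategoryTheory CategoryTheory.Limits

universe w v u

/-! ## Exact structures in the sense of Quillen -/

section

variable {C : Type u} [Category.{v} C] [Preadditive C]

/-- Given a class `E` of three-term complexes, a morphism `f` is an admissible monomorphism
if it is the first morphism of a complex in `E`. -/
def IsAdmissibleMono (E : ObjectProperty (ShortComplex C)) {X Y : C} (f : X ⟶ Y) : Prop :=
  ∃ (Z : C) (g : Y ⟶ Z) (h : f ≫ g = 0), E (ShortComplex.mk f g h)

/-- Given a class `E` of three-term complexes, a morphism `g` is an admissible epimorphism
if it is the second morphism of a complex in `E`. -/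
def IsAdmissibleEpi (E : ObjectProperty (ShortComplex C)) {Y Z : C} (g : Y ⟶ Z) : Prop :=
  ∃ (X : C) (f : X ⟶ Y) (h : f ≫ g = 0), E (ShortComplex.mk f g h)

/-- A kernel-cokernel pair: a three-term complex `X₁ ⟶ X₂ ⟶ X₃` whose first morphism is
a kernel of the second one, and whose second morphism is a cokernel of the first one. -/
def IsKernelCokernelPair (S : ShortComplex C) : Prop :=
  Nonempty (IsLimit (KernelFork.ofι S.f S.zero)) ∧
    Nonempty (IsColimit (CokernelCofork.ofπ S.g S.zero))

variable (C) in
/-- An exact structure (in the sense of Quillen) on a category `C` (which is additive in all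
the applications): an isomorphism-closed class of kernel-cokernel pairs, called (admissible)
short exact sequences, such that identity morphisms are admissible monomorphisms and admissible
epimorphisms, both classes are closed under compositions, pushouts of admissible
monomorphisms along arbitrary morphisms exist and are admissible monomorphisms, and dually. -/
@[ext]
structure QuillenExactStructure where
  /-- The class of admissible short exact sequences. -/
  shortExact : ObjectProperty (ShortComplex C)
  of_iso : ∀ {S T : ShortComplex C}, (S ≅ T) → shortExact S → shortExact T
  isKernelCokernelPair : ∀ {S : ShortComplex C}, shortExact S → IsKernelCokernelPair S
  admissibleMono_id : ∀ X : C, IsAdmissibleMono shortExact (𝟙 X)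
  admissibleEpi_id : ∀ X : C, IsAdmissibleEpi shortExact (𝟙 X)
  admissibleMono_comp : ∀ {X Y Z : C} (f : X ⟶ Y) (g : Y ⟶ Z),
    IsAdmissibleMono shortExact f → IsAdmissibleMono shortExact g →
      IsAdmissibleMono shortExact (f ≫ g)
  admissibleEpi_comp : ∀ {X Y Z : C} (f : X ⟶ Y) (g : Y ⟶ Z),
    IsAdmissibleEpi shortExact f → IsAdmissibleEpi shortExact g →
      IsAdmissibleEpi shortExact (f ≫ g)
  exists_pushout : ∀ {X Y X' : C} (f : X ⟶ Y) (a : X ⟶ X'), IsAdmissibleMono shortExact f →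
    ∃ (Y' : C) (a' : Y ⟶ Y') (f' : X' ⟶ Y'),
      IsPushout f a a' f' ∧ IsAdmissibleMono shortExact f'
  exists_pullback : ∀ {Y Z Z' : C} (g : Y ⟶ Z) (c : Z' ⟶ Z), IsAdmissibleEpi shortExact g →
    ∃ (Y' : C) (g' : Y' ⟶ Z') (c' : Y' ⟶ Y),
      IsPullback g' c' c g ∧ IsAdmissibleEpi shortExact g'

/-- The full subcategory given by `P` is closed under extensions in the exact structure `E`. -/
def QuillenExactStructure.IsExtensionClosed (E : QuillenExactStructure C)
    (P : ObjectProperty C) : Prop :=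
  ∀ S : ShortComplex C, E.shortExact S → P S.X₁ → P S.X₃ → P S.X₂

end

/-! ## Directed colimits and locally coherent exact structures -/

section

variable {C : Type u} [Category.{v} C]

/-- The objects that are colimits of `κ`-filtered small diagrams of objects satisfying `P`.
(Equivalently, `κ`-directed colimits: see `IsCardinalFiltered.exists_cardinal_directed`.) -/
def directedColimits (P : ObjectProperty C) (κ : Cardinal.{w}) [Fact κ.IsRegular] :
    ObjectProperty C := fun X ↦
  ∃ (J : Type w) (_ : SmallCategory J) (_ : IsCardinalFiltered J κ), P.colimitsOfShape J X

/-- The full subcategory `C_{<κ}` of `κ`-presentable objects. -/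
abbrev Presentables (C : Type u) [Category.{v} C] (κ : Cardinal.{w}) [Fact κ.IsRegular] :
    Type u :=
  (isCardinalPresentable C κ).FullSubcategory

/-- The inclusion functor `C_{<κ} ⥤ C`. -/
abbrev Presentables.incl (C : Type u) [Category.{v} C] (κ : Cardinal.{w}) [Fact κ.IsRegular] :
    Presentables C κ ⥤ C :=
  (isCardinalPresentable C κ).ι

/-- An exact structure is locally `κ`-coherent if its short exact sequences are precisely the
`κ`-directed colimits, in the category of three-term complexes, of short exact sequences
whose three terms are `κ`-presentable. -/
def QuillenExactStructure.IsLocallyCoherent [Preadditive C] (E : QuillenExactStructure C)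
    (κ : Cardinal.{w}) [Fact κ.IsRegular] : Prop :=
  ∀ S : ShortComplex C, E.shortExact S ↔
    directedColimits (fun T : ShortComplex C ↦ E.shortExact T ∧
      isCardinalPresentable C κ T.X₁ ∧ isCardinalPresentable C κ T.X₂ ∧
        isCardinalPresentable C κ T.X₃) κ S

end

/-! ## Ind-objects -/

section

/-- The category of ind-objects in a small preadditive category `S` that are representable by
`κ`-filtered diagrams: it is realized, as usual, as the full subcategory of the category of
presheaves of abelian groups on `S` which consists of the colimits of `κ`-filtered small
diagrams of representable presheaves. -/
abbrev CardinalInd (S : Type w) [SmallCategory S] [Preadditive S] (κ : Cardinal.{w})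
    [Fact κ.IsRegular] : Type (w + 1) :=
  (directedColimits (preadditiveYoneda (C := S)).essImage κ).FullSubcategory

variable (S : Type w) [SmallCategory S] [Preadditive S] (κ : Cardinal.{w}) [Fact κ.IsRegular]

lemma directedColimits_preadditiveYoneda (X : S) :
    directedColimits (preadditiveYoneda (C := S)).essImage κ (preadditiveYoneda.obj X) :=
  ⟨PUnit.{w + 1}, inferInstance,
    isCardinalFiltered_of_hasTerminal _ κ,
    ⟨{ toColimitPresentation := ColimitPresentation.self _
       prop_diag_obj := fun _ ↦ preadditiveYoneda.obj_mem_essImage X }⟩⟩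

/-- The canonical embedding of `S` into its category of ind-objects. -/
def CardinalInd.yoneda : S ⥤ CardinalInd S κ :=
  ObjectProperty.lift _ preadditiveYoneda (directedColimits_preadditiveYoneda S κ)

instance : (CardinalInd.yoneda S κ).Additive where
  map_add {X Y f g} := by
    apply ObjectProperty.hom_ext
    ext Z (h : Z.unop ⟶ X)
    exact Preadditive.comp_add _ _ _ h f g

end

/-! Everything reduces to one situation: a small additive category `S` with an exact structure `E`,
fully embedded by `i` in `A` as a `κ`-filtered generator. In (a), `S` is a small model of the
presentable objects; in (b), `A` is the category of ind-objects of `S`.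

Admissible epimorphisms of `S` behave like covers. Call `g` in `A` a local epimorphism if maps from
objects of `S` lift along it after such a cover, and let `locallyExact` consist of the local
epimorphisms with their kernels. The key fact, `directedColimits_iff_locallyExact`, is that these
are exactly the `κ`-directed colimits of sequences from `E`. Such colimits preserve kernels and
local epimorphisms because objects of `S` are presentable. Conversely, the sequences of `E` lying
over a local epimorphism `g : Y ⟶ Z` form a full cofinal subcategory of all squares from a morphism
of `S` to `g`: a morphism `u : Y₀ ⟶ Z₀` over `g` enlarges to an admissible epimorphism `Y₀ ⊞ T ⟶
Z₀`, where `T` covers `Z₀` and lifts to `Y`. The colimit of these sequences is `g` with its kernel,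
so local epimorphisms automatically have kernels.

The Quillen axioms follow (`exactStructure`). The epimorphism axioms use that local epimorphisms
compose, pull back and have kernels; pushouts are computed stagewise in `S`, and the cokernel of a
composite of monomorphisms is such a pushout.

Restricting back to `S` returns `E` by the "obscure axiom" (`locallyExact_map_iff`), and the short
five lemma shows that `S` is extension-closed. Conversely, in a locally coherent structure every
extension of presentable objects is a retract of a pushout of presentable objects. Finally, a
locally coherent structure for which `S` is extension-closed is recovered from its restriction to
`S` (`eq_exactStructure`); as presentable objects need only be retracts of objects of `S`, this
requires one extra pushout. -/

section

/-! ### Kernel-cokernel pairs, pushouts and pullbacks in existential form. -/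

variable {C : Type u} [Category.{v} C] [Preadditive C]

lemma nonempty_isLimit_kernelFork_iff {X Y Z : C} (f : X ⟶ Y) (g : Y ⟶ Z) (h : f ≫ g = 0) :
    Nonempty (IsLimit (KernelFork.ofι f h)) ↔
      Mono f ∧ ∀ ⦃W : C⦄ (k : W ⟶ Y), k ≫ g = 0 → ∃ l, l ≫ f = k := by
  constructor
  · rintro ⟨hf⟩
    refine ⟨⟨fun a b hab ↦ Fork.IsLimit.hom_ext hf hab⟩, fun W k hk ↦ ?_⟩
    exact ⟨_, (KernelFork.IsLimit.lift' hf k hk).2⟩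
  · rintro ⟨hf, hl⟩
    choose l hl using hl
    exact ⟨KernelFork.IsLimit.ofι _ _ (fun k hk ↦ l k hk) (fun k hk ↦ hl k hk)
      (fun k hk m hm ↦ by rw [← cancel_mono f, hm, hl])⟩

lemma nonempty_isColimit_cokernelCofork_iff {X Y Z : C} (f : X ⟶ Y) (g : Y ⟶ Z)
    (h : f ≫ g = 0) :
    Nonempty (IsColimit (CokernelCofork.ofπ g h)) ↔
      Epi g ∧ ∀ ⦃W : C⦄ (k : Y ⟶ W), f ≫ k = 0 → ∃ l, g ≫ l = k := by
  constructor
  · rintro ⟨hg⟩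
    refine ⟨⟨fun a b hab ↦ Cofork.IsColimit.hom_ext hg hab⟩, fun W k hk ↦ ?_⟩
    exact ⟨_, (CokernelCofork.IsColimit.desc' hg k hk).2⟩
  · rintro ⟨hg, hl⟩
    choose l hl using hl
    exact ⟨CokernelCofork.IsColimit.ofπ _ _ (fun k hk ↦ l k hk) (fun k hk ↦ hl k hk)
      (fun k hk m hm ↦ by rw [← cancel_epi g, hm, hl])⟩

lemma isKernelCokernelPair_iff (S : ShortComplex C) :
    IsKernelCokernelPair S ↔
      (Mono S.f ∧ ∀ ⦃W : C⦄ (k : W ⟶ S.X₂), k ≫ S.g = 0 → ∃ l, l ≫ S.f = k) ∧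
      (Epi S.g ∧ ∀ ⦃W : C⦄ (k : S.X₂ ⟶ W), S.f ≫ k = 0 → ∃ l, S.g ≫ l = k) :=
  and_congr (nonempty_isLimit_kernelFork_iff _ _ _) (nonempty_isColimit_cokernelCofork_iff _ _ _)

namespace IsKernelCokernelPair

variable {S : ShortComplex C} (h : IsKernelCokernelPair S)

include h

lemma mono : Mono S.f := ((isKernelCokernelPair_iff S).1 h).1.1

lemma epi : Epi S.g := ((isKernelCokernelPair_iff S).1 h).2.1

lemma exists_lift {W : C} (k : W ⟶ S.X₂) (hk : k ≫ S.g = 0) : ∃ l, l ≫ S.f = k :=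
  ((isKernelCokernelPair_iff S).1 h).1.2 k hk

lemma exists_desc {W : C} (k : S.X₂ ⟶ W) (hk : S.f ≫ k = 0) : ∃ l, S.g ≫ l = k :=
  ((isKernelCokernelPair_iff S).1 h).2.2 k hk

end IsKernelCokernelPair

/-- A commutative square is a pushout if the descent property holds in its existential form and
the cocone is jointly epimorphic. -/
lemma isPushout_of_exists {X Y X' P : C} {f : X ⟶ Y} {a : X ⟶ X'} {a' : Y ⟶ P} {f' : X' ⟶ P}
    (w : f ≫ a' = a ≫ f')
    (hd : ∀ ⦃W : C⦄ (u : Y ⟶ W) (v : X' ⟶ W), f ≫ u = a ≫ v → ∃ l, a' ≫ l = u ∧ f' ≫ l = v)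
    (hu : ∀ ⦃W : C⦄ (l : P ⟶ W), a' ≫ l = 0 → f' ≫ l = 0 → l = 0) :
    IsPushout f a a' f' := by
  choose l hl₁ hl₂ using hd
  exact ⟨⟨w⟩, ⟨PushoutCocone.IsColimit.mk _ (fun s ↦ l s.inl s.inr s.condition)
    (fun s ↦ hl₁ _ _ _) (fun s ↦ hl₂ _ _ _) (fun s m h₁ h₂ ↦ by
      rw [← sub_eq_zero]
      apply hu
      · rw [Preadditive.comp_sub, h₁, hl₁, sub_self]
      · rw [Preadditive.comp_sub, h₂, hl₂, sub_self])⟩⟩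

lemma isPullback_of_exists {P Y Z Z' : C} {g' : P ⟶ Z'} {c' : P ⟶ Y} {c : Z' ⟶ Z} {g : Y ⟶ Z}
    (w : g' ≫ c = c' ≫ g)
    (hd : ∀ ⦃W : C⦄ (u : W ⟶ Z') (v : W ⟶ Y), u ≫ c = v ≫ g → ∃ l, l ≫ g' = u ∧ l ≫ c' = v)
    (hu : ∀ ⦃W : C⦄ (l : W ⟶ P), l ≫ g' = 0 → l ≫ c' = 0 → l = 0) :
    IsPullback g' c' c g := by
  choose l hl₁ hl₂ using hd
  exact ⟨⟨w⟩, ⟨PullbackCone.IsLimit.mk _ (fun s ↦ l s.fst s.snd s.condition)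
    (fun s ↦ hl₁ _ _ _) (fun s ↦ hl₂ _ _ _) (fun s m h₁ h₂ ↦ by
      rw [← sub_eq_zero]
      apply hu
      · rw [Preadditive.sub_comp, h₁, hl₁, sub_self]
      · rw [Preadditive.sub_comp, h₂, hl₂, sub_self])⟩⟩

open scoped ZeroObject

/-! ### General properties of exact structures. -/

namespace QuillenExactStructure

variable (E : QuillenExactStructure C)

lemma of_iso_mk {X₁ X₂ X₃ Y₁ Y₂ Y₃ : C} {f : X₁ ⟶ X₂} {g : X₂ ⟶ X₃} {h : f ≫ g = 0}
    (hE : E.shortExact (ShortComplex.mk f g h)) {f' : Y₁ ⟶ Y₂} {g' : Y₂ ⟶ Y₃}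
    (h' : f' ≫ g' = 0) (e₁ : X₁ ≅ Y₁) (e₂ : X₂ ≅ Y₂) (e₃ : X₃ ≅ Y₃)
    (w₁ : e₁.hom ≫ f' = f ≫ e₂.hom) (w₂ : e₂.hom ≫ g' = g ≫ e₃.hom) :
    E.shortExact (ShortComplex.mk f' g' h') :=
  E.of_iso (S := .mk f g h) (T := .mk f' g' h') (ShortComplex.isoMk e₁ e₂ e₃ w₁ w₂) hE

/-- A kernel of an admissible epimorphism gives a short exact sequence. -/
lemma shortExact_of_isLimit {S : ShortComplex C} (hg : IsAdmissibleEpi E.shortExact S.g)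
    (hf : Nonempty (IsLimit (KernelFork.ofι S.f S.zero))) : E.shortExact S := by
  obtain ⟨X, f, h, hE⟩ := hg
  obtain ⟨hf'⟩ := (E.isKernelCokernelPair hE).1
  obtain ⟨hf⟩ := hf
  refine E.of_iso (S := .mk f S.g h) (ShortComplex.isoMk (IsLimit.conePointUniqueUpToIso hf' hf)
    (Iso.refl _) (Iso.refl _) ?_ (by simp)) hE
  have := IsLimit.conePointUniqueUpToIso_hom_comp hf' hf WalkingParallelPair.zero
  simpa using! this

/-- A cokernel of an admissible monomorphism gives a short exact sequence. -/
lemma shortExact_of_isColimit {S : ShortComplex C} (hf : IsAdmissibleMono E.shortExact S.f)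
    (hg : Nonempty (IsColimit (CokernelCofork.ofπ S.g S.zero))) : E.shortExact S := by
  obtain ⟨X, f, h, hE⟩ := hf
  obtain ⟨hf'⟩ := (E.isKernelCokernelPair hE).2
  obtain ⟨hg⟩ := hg
  refine E.of_iso (S := .mk S.f f h) (ShortComplex.isoMk (Iso.refl _) (Iso.refl _)
    (IsColimit.coconePointUniqueUpToIso hf' hg) (by simp) ?_) hE
  have := IsColimit.comp_coconePointUniqueUpToIso_hom hf' hg WalkingParallelPair.one
  simpa using! this.symm

lemma admissibleMono_of_isPushout {X Y X' P : C} {f : X ⟶ Y} {a : X ⟶ X'} {a' : Y ⟶ P}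
    {f' : X' ⟶ P} (h : IsPushout f a a' f') (hf : IsAdmissibleMono E.shortExact f) :
    IsAdmissibleMono E.shortExact f' := by
  obtain ⟨Q, b', q, hq, Z, g, hg, hE⟩ := E.exists_pushout f a hf
  let e := hq.isoIsPushout _ _ h
  refine ⟨Z, e.inv ≫ g, ?_, E.of_iso (S := .mk q g hg)
    (ShortComplex.isoMk (Iso.refl _) e (Iso.refl _) ?_ ?_) hE⟩
  · simp [e, hg]
  · simp [e]
  · simp

lemma admissibleEpi_of_isPullback {P Y Z Z' : C} {g' : P ⟶ Z'} {c' : P ⟶ Y} {c : Z' ⟶ Z}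
    {g : Y ⟶ Z} (h : IsPullback g' c' c g) (hg : IsAdmissibleEpi E.shortExact g) :
    IsAdmissibleEpi E.shortExact g' := by
  obtain ⟨Q, b', q, hq, Z, f, hf, hE⟩ := E.exists_pullback g c hg
  let e := hq.isoIsPullback _ _ h
  refine ⟨Z, f ≫ e.hom, ?_, E.of_iso (S := .mk f b' hf)
    (ShortComplex.isoMk (Iso.refl _) e (Iso.refl _) ?_ ?_) hE⟩
  · simp [e, hf]
  · simp
  · simp [e]

/-- The pushout of a short exact sequence along a morphism from its first term. -/
lemma shortExact_of_isPushout {S : ShortComplex C} (hS : E.shortExact S) {X' P : C}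
    {a : S.X₁ ⟶ X'} {a' : S.X₂ ⟶ P} {f' : X' ⟶ P} (h : IsPushout S.f a a' f')
    (c : P ⟶ S.X₃) (hc : a' ≫ c = S.g) (hc' : f' ≫ c = 0) :
    E.shortExact (ShortComplex.mk f' c hc') := by
  have hp := E.isKernelCokernelPair hS
  have := hp.epi
  refine E.shortExact_of_isColimit (E.admissibleMono_of_isPushout h ⟨_, _, _, hS⟩)
    ((nonempty_isColimit_cokernelCofork_iff _ _ _).2 ⟨?_, fun W k hk ↦ ?_⟩)
  · have : Epi (a' ≫ c) := by rwa [hc]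
    exact epi_of_epi a' c
  · dsimp at hk
    obtain ⟨l, hl⟩ := hp.exists_desc (a' ≫ k) (by rw [h.w_assoc, hk, comp_zero])
    refine ⟨l, h.hom_ext ?_ ?_⟩
    · rw [reassoc_of% hc, hl]
    · rw [reassoc_of% hc', hk, zero_comp]

lemma shortExact_of_isPullback {S : ShortComplex C} (hS : E.shortExact S) {Z' P : C}
    {c : Z' ⟶ S.X₃} {c' : P ⟶ S.X₂} {g' : P ⟶ Z'} (h : IsPullback g' c' c S.g)
    (a : S.X₁ ⟶ P) (ha : a ≫ c' = S.f) (ha' : a ≫ g' = 0) :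
    E.shortExact (ShortComplex.mk a g' ha') := by
  have hp := E.isKernelCokernelPair hS
  have := hp.mono
  refine E.shortExact_of_isLimit (E.admissibleEpi_of_isPullback h ⟨_, _, _, hS⟩)
    ((nonempty_isLimit_kernelFork_iff _ _ _).2 ⟨?_, fun W k hk ↦ ?_⟩)
  · have : Mono (a ≫ c') := by rwa [ha]
    exact mono_of_mono a c'
  · dsimp at hk
    obtain ⟨l, hl⟩ := hp.exists_lift (k ≫ c') (by
      rw [Category.assoc, ← h.w, reassoc_of% hk, zero_comp])
    refine ⟨l, h.hom_ext ?_ ?_⟩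
    · rw [Category.assoc, ha', hk, comp_zero]
    · rw [Category.assoc, ha, hl]

lemma exists_pushout_shortExact {S : ShortComplex C} (hS : E.shortExact S) {X' : C}
    (a : S.X₁ ⟶ X') : ∃ (P : C) (a' : S.X₂ ⟶ P) (f' : X' ⟶ P) (g' : P ⟶ S.X₃)
      (h : f' ≫ g' = 0), IsPushout S.f a a' f' ∧ a' ≫ g' = S.g ∧
        E.shortExact (ShortComplex.mk f' g' h) := by
  obtain ⟨P, a', f', h, -⟩ := E.exists_pushout S.f a ⟨_, _, _, hS⟩
  have w : S.f ≫ S.g = a ≫ 0 := by simp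
  exact ⟨P, a', f', h.desc S.g 0 w, h.inr_desc _ _ w, h, h.inl_desc _ _ w,
    E.shortExact_of_isPushout hS h _ (h.inl_desc _ _ w) (h.inr_desc _ _ w)⟩

lemma exists_pullback_shortExact {S : ShortComplex C} (hS : E.shortExact S) {Z' : C}
    (c : Z' ⟶ S.X₃) : ∃ (P : C) (c' : P ⟶ S.X₂) (f' : S.X₁ ⟶ P) (g' : P ⟶ Z')
      (h : f' ≫ g' = 0), IsPullback g' c' c S.g ∧ f' ≫ c' = S.f ∧
        E.shortExact (ShortComplex.mk f' g' h) := by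
  obtain ⟨P, g', c', h, -⟩ := E.exists_pullback S.g c ⟨_, _, _, hS⟩
  have w : 0 ≫ c = S.f ≫ S.g := by simp
  exact ⟨P, c', h.lift 0 S.f w, g', h.lift_fst _ _ w, h, h.lift_snd _ _ w,
    E.shortExact_of_isPullback hS h _ (h.lift_snd _ _ w) (h.lift_fst _ _ w)⟩

lemma shortExact_id_right (X Z : C) (hZ : IsZero Z) :
    E.shortExact (ShortComplex.mk (𝟙 X) (0 : X ⟶ Z) (by simp)) := by
  refine E.shortExact_of_isColimit (E.admissibleMono_id X)
    ((nonempty_isColimit_cokernelCofork_iff _ _ _).2 ⟨⟨fun _ _ _ ↦ hZ.eq_of_src _ _⟩,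
      fun W k hk ↦ ⟨0, ?_⟩⟩)
  simpa using hk.symm

lemma shortExact_id_left (X Z : C) (hZ : IsZero Z) :
    E.shortExact (ShortComplex.mk (0 : Z ⟶ X) (𝟙 X) (by simp)) := by
  refine E.shortExact_of_isLimit (E.admissibleEpi_id X)
    ((nonempty_isLimit_kernelFork_iff _ _ _).2 ⟨⟨fun _ _ _ ↦ hZ.eq_of_tgt _ _⟩,
      fun W k hk ↦ ⟨0, ?_⟩⟩)
  simpa using hk.symm

lemma admissibleEpi_of_isIso {X Y : C} (f : X ⟶ Y) [IsIso f] :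
    IsAdmissibleEpi E.shortExact f :=
  E.admissibleEpi_of_isPullback (c' := f) (c := 𝟙 Y) (g := 𝟙 Y)
    (IsPullback.of_vert_isIso ⟨by simp⟩ |>.flip) (E.admissibleEpi_id Y)

variable [HasZeroObject C] [HasBinaryBiproducts C]

/-- The projection is a pullback of `X ⟶ 0`, which is the cokernel of the identity of `X`. -/
lemma admissibleEpi_biprod_snd (X Y : C) :
    IsAdmissibleEpi E.shortExact (biprod.snd : X ⊞ Y ⟶ Y) := by
  refine E.admissibleEpi_of_isPullback (c' := biprod.fst) (Z := (0 : C)) (c := 0)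
    (g := (0 : X ⟶ (0 : C)))
    (isPullback_of_exists (by simp) (fun W u v _ ↦ ⟨biprod.lift v u, by simp, by simp⟩)
      (fun W l h₁ h₂ ↦ biprod.hom_ext _ _ (by simpa using h₂) (by simpa using h₁)))
    ⟨_, _, _, E.shortExact_id_right X (0 : C) (isZero_zero C)⟩

/-- If `b` is an admissible epimorphism, then so is `(a, b) : Y ⊞ W ⟶ Z`. -/
lemma admissibleEpi_biprod_desc {Y W Z : C} (a : Y ⟶ Z) {b : W ⟶ Z}
    (hb : IsAdmissibleEpi E.shortExact b) :
    IsAdmissibleEpi E.shortExact (biprod.desc a b) := by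
  -- The morphism `(a, b)` is `1 ⊞ b`, followed by a shear of `Y ⊞ Z`, followed by the second
  -- projection. The first factor is a pullback of `b`.
  have h₁ : IsAdmissibleEpi E.shortExact (biprod.map (𝟙 Y) b) := by
    refine E.admissibleEpi_of_isPullback (c := biprod.snd) (c' := biprod.snd) ?_ hb
    refine isPullback_of_exists (by simp) (fun T u v h ↦ ⟨biprod.lift (u ≫ biprod.fst) v, ?_, ?_⟩)
      (fun T l h₁ h₂ ↦ biprod.hom_ext _ _ ?_ (by simpa using h₂))
    · ext <;> simp [h]
    · simp
    · simpa using congr($h₁ ≫ biprod.fst)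
  let e : Y ⊞ Z ≅ Y ⊞ Z :=
    { hom := biprod.lift biprod.fst (biprod.fst ≫ a + biprod.snd)
      inv := biprod.lift biprod.fst (-biprod.fst ≫ a + biprod.snd)
      hom_inv_id := by ext <;> simp
      inv_hom_id := by ext <;> simp }
  have := e.isIso_hom
  have he := E.admissibleEpi_of_isIso e.hom
  have h₂ := E.admissibleEpi_comp _ _ h₁ (E.admissibleEpi_comp _ _
    he (E.admissibleEpi_biprod_snd Y Z))
  convert h₂ using 1
  ext <;> simp [e]

/-- The "obscure axiom": if `h ≫ g` is an admissible epimorphism and `g` has a kernel, then `g` is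
an admissible epimorphism. -/
lemma shortExact_of_admissibleEpi_comp {S : ShortComplex C}
    (hf : Nonempty (IsLimit (KernelFork.ofι S.f S.zero))) {W : C} (h : W ⟶ S.X₂)
    (hg : IsAdmissibleEpi E.shortExact (h ≫ S.g)) : E.shortExact S := by
  obtain ⟨_, hl⟩ := (nonempty_isLimit_kernelFork_iff _ _ _).1 hf
  -- This shear turns `(g, h ≫ g)`, an admissible epimorphism, into `(g, 0)`, whose kernel is `S.f ⊞
  -- 1`.
  let e : S.X₂ ⊞ W ≅ S.X₂ ⊞ W :=
    { hom := biprod.lift (biprod.fst - biprod.snd ≫ h) biprod.snd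
      inv := biprod.lift (biprod.fst + biprod.snd ≫ h) biprod.snd
      hom_inv_id := by ext <;> simp
      inv_hom_id := by ext <;> simp }
  have h₁ : IsAdmissibleEpi E.shortExact (biprod.fst ≫ S.g : S.X₂ ⊞ W ⟶ S.X₃) := by
    have := e.isIso_hom
    have he := E.admissibleEpi_of_isIso e.hom
    have := E.admissibleEpi_comp _ _ he
      (E.admissibleEpi_biprod_desc S.g hg)
    convert this using 1
    ext <;> simp [e]
  have h₂ : E.shortExact (ShortComplex.mk (biprod.map S.f (𝟙 W)) (biprod.fst ≫ S.g)
      (by simp [S.zero])) := by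
    refine E.shortExact_of_isLimit h₁ ((nonempty_isLimit_kernelFork_iff _ _ _).2
      ⟨inferInstance, fun T k hk ↦ ?_⟩)
    obtain ⟨l, hl⟩ := hl (k ≫ biprod.fst) (by simpa using hk)
    exact ⟨biprod.lift l (k ≫ biprod.snd), by ext <;> simp [hl]⟩
  -- Pushing out along the projection `S.X₁ ⊞ W ⟶ S.X₁` removes the summand `W`.
  refine E.shortExact_of_isPushout h₂ (a := biprod.fst) (a' := biprod.fst) (f' := S.f) ?_ S.g
    (by simp) S.zero
  refine isPushout_of_exists (by simp) (fun T u v huv ↦ ⟨biprod.inl ≫ u, ?_, ?_⟩)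
    (fun T l h₁ _ ↦ by simpa using congr(biprod.inl ≫ $h₁))
  · ext
    · simp
    · simpa using congr(biprod.inr ≫ $huv.symm)
  · simpa using congr(biprod.inl ≫ $huv)

omit [HasZeroObject C] [HasBinaryBiproducts C] in
/-- A morphism of short exact sequences `(𝟙, b, c)` where `c` is a split epimorphism has
a split epimorphism as its middle component. -/
lemma exists_section_of_shortExact {S T : ShortComplex C} (hS : E.shortExact S)
    (hT : E.shortExact T) (φ : S ⟶ T) [IsIso φ.τ₁] (s : T.X₃ ⟶ S.X₃) (hs : s ≫ φ.τ₃ = 𝟙 _) :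
    ∃ σ : T.X₂ ⟶ S.X₂, σ ≫ φ.τ₂ = 𝟙 _ := by
  have hS' := E.isKernelCokernelPair hS
  have hT' := E.isKernelCokernelPair hT
  have := hT'.mono
  -- On the pullback, `c' ≫ φ.τ₂` and `d` agree after `T.g`, so they differ by some `x ≫ T.f`.
  -- Correcting `c'` by `x` gives `r` with `r ≫ φ.τ₂ = d`; it vanishes on the kernel of `d`, hence
  -- descends to the section.
  obtain ⟨P, c', k, d, hkd, sq, hc', hP⟩ := E.exists_pullback_shortExact hS (T.g ≫ s)
  have hP' := E.isKernelCokernelPair hP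
  obtain ⟨x, hx⟩ := hT'.exists_lift (c' ≫ φ.τ₂ - d) (by
    rw [Preadditive.sub_comp, Category.assoc, φ.comm₂₃, ← sq.w_assoc, Category.assoc, hs,
      Category.comp_id, sub_self])
  let r : P ⟶ S.X₂ := c' - x ≫ inv φ.τ₁ ≫ S.f
  have hr : r ≫ φ.τ₂ = d := by
    simp [r, ← φ.comm₁₂, hx]
  obtain ⟨σ, hσ⟩ := hP'.exists_desc r (by
    have h₁ : (k ≫ r) ≫ S.g = 0 := by
      simp [r, reassoc_of% hc', S.zero]
    obtain ⟨y, hy⟩ := hS'.exists_lift _ h₁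
    have h₂ : (y ≫ φ.τ₁) ≫ T.f = 0 := by
      rw [Category.assoc, φ.comm₁₂, reassoc_of% hy, hr, hkd]
    have h₃ : y ≫ φ.τ₁ = 0 := by rwa [← cancel_mono T.f, zero_comp]
    have h₄ : y = 0 := by rwa [← cancel_mono φ.τ₁, zero_comp]
    rw [← hy, h₄, zero_comp])
  have := hP'.epi
  refine ⟨σ, ?_⟩
  rw [← cancel_epi d, Category.comp_id]
  dsimp at hσ
  rw [reassoc_of% hσ, hr]

omit [HasZeroObject C] [HasBinaryBiproducts C] in
-- Short five lemma: the section of `φ.τ₃` given by its inverse yields a section of `φ.τ₂`, and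
-- `φ.τ₂` is mono by a diagram chase.
lemma isIso_of_shortExact {S T : ShortComplex C} (hS : E.shortExact S)
    (hT : E.shortExact T) (φ : S ⟶ T) [IsIso φ.τ₁] [IsIso φ.τ₃] : IsIso φ.τ₂ := by
  obtain ⟨σ, hσ⟩ := E.exists_section_of_shortExact hS hT φ (inv φ.τ₃) (by simp)
  have hS' := E.isKernelCokernelPair hS
  have := (E.isKernelCokernelPair hT).mono
  have : Mono φ.τ₂ := by
    refine Preadditive.mono_of_cancel_zero _ (fun {W} k hk ↦ ?_)
    obtain ⟨l, hl⟩ := hS'.exists_lift k (by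
      rw [← cancel_mono φ.τ₃, Category.assoc, ← φ.comm₂₃, reassoc_of% hk, zero_comp, zero_comp])
    have h₂ : (l ≫ φ.τ₁) ≫ T.f = 0 := by
      rw [Category.assoc, φ.comm₁₂, reassoc_of% hl, hk]
    have h₃ : l ≫ φ.τ₁ = 0 := by rwa [← cancel_mono T.f, zero_comp]
    have h₄ : l = 0 := by rwa [← cancel_mono φ.τ₁, zero_comp]
    rw [← hl, h₄, zero_comp]
  have : IsSplitEpi φ.τ₂ := ⟨⟨⟨σ, hσ⟩⟩⟩
  exact isIso_of_mono_of_isSplitEpi _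

end QuillenExactStructure

end

/-! ### Exact structures inherited by extension-closed full subcategories. -/

section

universe v' u'

variable {S : Type u'} [Category.{v'} S] [Preadditive S] {A : Type u} [Category.{v} A]
  [Preadditive A]

lemma isKernelCokernelPair_of_map (i : S ⥤ A) [i.Full] [i.Faithful] [i.Additive]
    {T : ShortComplex S} (hT : IsKernelCokernelPair (T.map i)) : IsKernelCokernelPair T := by
  have w : i.map T.f ≫ i.map T.g = 0 := by rw [← i.map_comp, T.zero, i.map_zero]
  replace hT : IsKernelCokernelPair (ShortComplex.mk _ _ w) := hT
  have hm : Mono (i.map T.f) := hT.mono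
  have he : Epi (i.map T.g) := hT.epi
  refine (isKernelCokernelPair_iff T).2 ⟨⟨i.mono_of_mono_map hm, fun W k hk ↦ ?_⟩,
    ⟨i.epi_of_epi_map he, fun W k hk ↦ ?_⟩⟩
  · obtain ⟨l, hl⟩ := hT.exists_lift (i.map k) (by
      dsimp
      rw [← i.map_comp, hk, i.map_zero])
    exact ⟨i.preimage l, i.map_injective (by simpa using! hl)⟩
  · obtain ⟨l, hl⟩ := hT.exists_desc (i.map k) (by
      dsimp
      rw [← i.map_comp, hk, i.map_zero])
    exact ⟨i.preimage l, i.map_injective (by simpa using! hl)⟩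

namespace QuillenExactStructure

variable (F : QuillenExactStructure A) (i : S ⥤ A) [i.Full] [i.Faithful] [i.Additive]

lemma isAdmissibleMono_of_map {X Y : S} {f : X ⟶ Y} {Z : A} (hZ : i.essImage Z)
    {g : i.obj Y ⟶ Z} (h : i.map f ≫ g = 0) (hF : F.shortExact (ShortComplex.mk _ g h)) :
    IsAdmissibleMono (fun T : ShortComplex S ↦ F.shortExact (T.map i)) f := by
  obtain ⟨Z', ⟨e⟩⟩ := hZ
  exact ⟨Z', i.preimage (g ≫ e.inv), i.map_injective (by simp [reassoc_of% h]),
    F.of_iso_mk hF _ (Iso.refl _) (Iso.refl _) e.symm (by simp) (by simp)⟩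

lemma isAdmissibleEpi_of_map {Y Z : S} {g : Y ⟶ Z} {X : A} (hX : i.essImage X)
    {f : X ⟶ i.obj Y} (h : f ≫ i.map g = 0) (hF : F.shortExact (ShortComplex.mk f _ h)) :
    IsAdmissibleEpi (fun T : ShortComplex S ↦ F.shortExact (T.map i)) g := by
  obtain ⟨X', ⟨e⟩⟩ := hX
  exact ⟨X', i.preimage (e.hom ≫ f), i.map_injective (by simp [h]),
    F.of_iso_mk hF _ e.symm (Iso.refl _) (Iso.refl _) (by simp) (by simp)⟩

variable [HasZeroObject S]

open ZeroObject

/-- The exact structure inherited by an extension-closed full subcategory. -/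
def inherit (hi : F.IsExtensionClosed i.essImage) : QuillenExactStructure S where
  shortExact T := F.shortExact (T.map i)
  of_iso e h := F.of_iso (i.mapShortComplex.mapIso e) h
  isKernelCokernelPair h := isKernelCokernelPair_of_map i (F.isKernelCokernelPair h)
  admissibleMono_id X := by
    have h0 := i.map_isZero (isZero_zero S)
    have : HasZeroObject A := ⟨_, h0⟩
    refine F.isAdmissibleMono_of_map i (Z := i.obj 0) (i.obj_mem_essImage _) (g := 0) (by simp) ?_
    simpa using! F.shortExact_id_right (i.obj X) _ h0
  admissibleEpi_id X := by
    have h0 := i.map_isZero (isZero_zero S)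
    have : HasZeroObject A := ⟨_, h0⟩
    refine F.isAdmissibleEpi_of_map i (X := i.obj 0) (i.obj_mem_essImage _) (f := 0) (by simp) ?_
    simpa using! F.shortExact_id_left (i.obj X) _ h0
  admissibleMono_comp {X Y Z} f g := by
    rintro ⟨C, p, hp, hE⟩ ⟨D, q, hq, hE'⟩
    have w₁ : i.map f ≫ i.map p = 0 := by rw [← i.map_comp, hp, i.map_zero]
    have w₂ : i.map g ≫ i.map q = 0 := by rw [← i.map_comp, hq, i.map_zero]
    replace hE : F.shortExact (ShortComplex.mk _ _ w₁) := hE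
    replace hE' : F.shortExact (ShortComplex.mk _ _ w₂) := hE'
    -- The cokernel of the composite is the pushout `P` of the second monomorphism along the
    -- cokernel `p` of the first. It is an extension of `i.obj D` by `i.obj C`, so it stays in the
    -- subcategory.
    obtain ⟨P, a', c, d, hcd, sq, had, hP⟩ := F.exists_pushout_shortExact hE' (i.map p)
    dsimp at a' c d hcd sq had hP
    have hE₁ := F.isKernelCokernelPair hE
    have := hE₁.epi
    dsimp at this
    have w : i.map (f ≫ g) ≫ a' = 0 := by
      rw [i.map_comp, Category.assoc, sq.w, ← i.map_comp_assoc, hp, i.map_zero, zero_comp]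
    refine F.isAdmissibleMono_of_map i (hi _ hP (i.obj_mem_essImage _) (i.obj_mem_essImage _)) w
      (F.shortExact_of_isColimit ?_ ((nonempty_isColimit_cokernelCofork_iff _ _ _).2
        ⟨Preadditive.epi_of_cancel_zero _ fun {W} k hk ↦ ?_, fun W k hk ↦ ?_⟩))
    · dsimp
      rw [i.map_comp]
      exact F.admissibleMono_comp _ _ ⟨_, _, _, hE⟩ ⟨_, _, _, hE'⟩
    · refine sq.hom_ext (by rw [hk, comp_zero]) ?_
      rw [← cancel_epi (i.map p), ← sq.w_assoc, hk, comp_zero, comp_zero, comp_zero]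
    · dsimp at k hk
      obtain ⟨l, hl⟩ := hE₁.exists_desc (i.map g ≫ k) (by
        dsimp
        rw [← hk, i.map_comp, Category.assoc])
      exact ⟨sq.desc k l hl.symm, sq.inl_desc _ _ _⟩
  admissibleEpi_comp {X Y Z} f g := by
    rintro ⟨K, p, hp, hE⟩ ⟨L, q, hq, hE'⟩
    have w₁ : i.map p ≫ i.map f = 0 := by rw [← i.map_comp, hp, i.map_zero]
    have w₂ : i.map q ≫ i.map g = 0 := by rw [← i.map_comp, hq, i.map_zero]
    replace hE : F.shortExact (ShortComplex.mk _ _ w₁) := hE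
    replace hE' : F.shortExact (ShortComplex.mk _ _ w₂) := hE'
    -- Dually, the kernel of the composite is an extension of `i.obj L` by `i.obj K`.
    obtain ⟨P, c', k, d, hkd, sq, had, hP⟩ := F.exists_pullback_shortExact hE (i.map q)
    dsimp at c' k d hkd sq had hP
    have hE₁ := F.isKernelCokernelPair hE'
    have := hE₁.mono
    dsimp at this
    have w : c' ≫ i.map (f ≫ g) = 0 := by
      rw [i.map_comp, ← sq.w_assoc, ← i.map_comp, hq, i.map_zero, comp_zero]
    refine F.isAdmissibleEpi_of_map i (hi _ hP (i.obj_mem_essImage _) (i.obj_mem_essImage _)) w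
      (F.shortExact_of_isLimit ?_ ((nonempty_isLimit_kernelFork_iff _ _ _).2
        ⟨Preadditive.mono_of_cancel_zero _ fun {W} k hk ↦ ?_, fun W k hk ↦ ?_⟩))
    · dsimp
      rw [i.map_comp]
      exact F.admissibleEpi_comp _ _ ⟨_, _, _, hE⟩ ⟨_, _, _, hE'⟩
    · refine sq.hom_ext ?_ (by rw [hk, zero_comp])
      rw [← cancel_mono (i.map q), Category.assoc, sq.w, reassoc_of% hk, zero_comp, zero_comp,
        zero_comp]
    · dsimp at k hk
      obtain ⟨l, hl⟩ := hE₁.exists_lift (k ≫ i.map f) (by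
        dsimp
        rw [← hk, i.map_comp, Category.assoc])
      exact ⟨sq.lift l k hl, sq.lift_snd _ _ _⟩
  exists_pushout {X Y X'} f a := by
    rintro ⟨Z, g, hg, hE⟩
    have w : i.map f ≫ i.map g = 0 := by rw [← i.map_comp, hg, i.map_zero]
    replace hE : F.shortExact (ShortComplex.mk _ _ w) := hE
    obtain ⟨P, a', f', d, hcd, sq, had, hP⟩ := F.exists_pushout_shortExact hE (i.map a)
    obtain ⟨P', ⟨e⟩⟩ := hi _ hP (i.obj_mem_essImage _) (i.obj_mem_essImage _)
    dsimp at a' f' d hcd sq had hP e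
    refine ⟨P', i.preimage (a' ≫ e.inv), i.preimage (f' ≫ e.inv), ?_, Z, i.preimage (e.hom ≫ d),
      i.map_injective (by simp [hcd]), F.of_iso_mk hP _
        (Iso.refl _) e.symm (Iso.refl _) (by simp) (by simp)⟩
    refine IsPushout.of_map i (i.map_injective (by simp [sq.w_assoc])) ?_
    exact sq.of_iso (Iso.refl _) (Iso.refl _) (Iso.refl _) e.symm (by simp) (by simp) (by simp)
      (by simp)
  exists_pullback {Y Z Z'} g c := by
    rintro ⟨X, f, hg, hE⟩
    have w : i.map f ≫ i.map g = 0 := by rw [← i.map_comp, hg, i.map_zero]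
    replace hE : F.shortExact (ShortComplex.mk _ _ w) := hE
    obtain ⟨P, c', f', g', hcd, sq, had, hP⟩ := F.exists_pullback_shortExact hE (i.map c)
    obtain ⟨P', ⟨e⟩⟩ := hi _ hP (i.obj_mem_essImage _) (i.obj_mem_essImage _)
    dsimp at c' f' g' hcd sq had hP e
    refine ⟨P', i.preimage (e.hom ≫ g'), i.preimage (e.hom ≫ c'), ?_, X, i.preimage (f' ≫ e.inv),
      i.map_injective (by simp [hcd]), F.of_iso_mk hP _
        (Iso.refl _) e.symm (Iso.refl _) (by simp) (by simp)⟩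
    refine IsPullback.of_map i (i.map_injective (by simp [sq.w])) ?_
    exact sq.of_iso e.symm (Iso.refl _) (Iso.refl _) (Iso.refl _) (by simp) (by simp) (by simp)
      (by simp)

end QuillenExactStructure

end

/-! ### Cardinal filteredness of comma categories and of cofinal full subcategories. -/

section

universe v₁ v₂ u₁ u₂

/-- The comma category of a functor between `κ`-filtered categories is `κ`-filtered. -/
lemma isCardinalFiltered_comma_id {J : Type u₁} [Category.{v₁} J] {K : Type u₂} [Category.{v₂} K]
    (F : J ⥤ K) (κ : Cardinal.{w}) [Fact κ.IsRegular] [IsCardinalFiltered J κ]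
    [IsCardinalFiltered K κ] : IsCardinalFiltered (Comma F (𝟭 K)) κ where
  nonempty_cocone {B _} D hB := by
    have := isFiltered_of_isCardinalFiltered K κ
    let c₁ := IsCardinalFiltered.cocone (D ⋙ Comma.fst _ _) hB
    let c₂ := IsCardinalFiltered.cocone (D ⋙ Comma.snd _ _) hB
    -- Cocones chosen independently on the two sides need not be compatible with the structure
    -- morphisms; there are fewer than `κ` of these, so one further morphism makes all the squares
    -- commute.
    obtain ⟨l, a, ha⟩ := IsCardinalFiltered.multicoequalizer
      (j := fun b ↦ F.obj (D.obj b).left)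
      (fun b ↦ F.map (c₁.ι.app b) ≫ IsFiltered.leftToMax (F.obj c₁.pt) c₂.pt)
      (fun b ↦ (D.obj b).hom ≫ c₂.ι.app b ≫ IsFiltered.rightToMax (F.obj c₁.pt) c₂.pt)
      (hasCardinalLT_of_hasCardinalLT_arrow hB)
    simp only [Category.assoc] at ha
    exact ⟨{
      pt := { left := c₁.pt, right := l, hom := IsFiltered.leftToMax _ _ ≫ a }
      ι := {
        app b :=
          { left := c₁.ι.app b
            right := c₂.ι.app b ≫ IsFiltered.rightToMax _ _ ≫ a
            w := ha b }
        naturality b b' f := by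
          ext
          · exact c₁.ι.naturality f
          · have : (D.map f).right ≫ c₂.ι.app b' = c₂.ι.app b := c₂.w f
            dsimp
            simp only [reassoc_of% this, Category.comp_id] } }⟩

lemma isCardinalFiltered_of_full_of_faithful {J : Type u₁} [Category.{v₁} J] {K : Type u₂}
    [Category.{v₂} K] (F : J ⥤ K) [F.Full] [F.Faithful] (κ : Cardinal.{w}) [Fact κ.IsRegular]
    [IsCardinalFiltered K κ] (h : ∀ k : K, ∃ j, Nonempty (k ⟶ F.obj j)) :
    IsCardinalFiltered J κ where
  nonempty_cocone {B _} D hB := by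
    let c := IsCardinalFiltered.cocone (D ⋙ F) hB
    obtain ⟨j, ⟨φ⟩⟩ := h c.pt
    exact ⟨{
      pt := j
      ι := {
        app b := F.preimage (c.ι.app b ≫ φ)
        naturality b b' f := F.map_injective (by
          have := c.w f
          dsimp at this
          simp [reassoc_of% this]) } }⟩

end

/-! ### Testing morphisms, kernels and colimits on a `κ`-filtered generator. -/

section

variable {S : Type w} [SmallCategory S] {A : Type u} [Category.{w} A] (i : S ⥤ A)

/-- The canonical cocone exhibiting an object as a cocone over the objects of a subcategory. -/
@[simps]
def canonicalCocone (X : A) : Cocone (CostructuredArrow.proj i X ⋙ i) where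
  pt := X
  ι :=
    { app f := f.hom
      naturality _ _ φ := (CostructuredArrow.w φ).trans (Category.comp_id _).symm }

end

namespace CategoryTheory.ObjectProperty.IsCardinalFilteredGenerator

variable {S : Type w} [SmallCategory S] {A : Type u} [Category.{w} A] {i : S ⥤ A}
  {κ : Cardinal.{w}} [Fact κ.IsRegular] (hi : i.essImage.IsCardinalFilteredGenerator κ)

include hi

lemma isCardinalPresentable_obj (s : S) : IsCardinalPresentable (i.obj s) κ :=
  hi.le_isCardinalPresentable _ (i.obj_mem_essImage s)

lemma hom_ext {X Y : A} {f g : X ⟶ Y} (h : ∀ (s : S) (x : i.obj s ⟶ X), x ≫ f = x ≫ g) :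
    f = g := by
  obtain ⟨J, _, _, ⟨p⟩⟩ := hi.exists_colimitsOfShape X
  refine p.isColimit.hom_ext fun j ↦ ?_
  obtain ⟨s, ⟨e⟩⟩ := p.prop_diag_obj j
  rw [← cancel_epi e.hom]
  simpa using h s (e.hom ≫ p.ι.app j)

/-- As `f` is mono, the lifts on a presentation of `W` are unique, hence compatible, and they glue.
-/
lemma exists_lift {X Y W : A} (f : X ⟶ Y) [Mono f] (k : W ⟶ Y)
    (h : ∀ (s : S) (x : i.obj s ⟶ W), ∃ l, l ≫ f = x ≫ k) : ∃ l, l ≫ f = k := by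
  obtain ⟨J, _, _, ⟨p⟩⟩ := hi.exists_colimitsOfShape W
  have (j : J) : ∃ l, l ≫ f = p.ι.app j ≫ k := by
    obtain ⟨s, ⟨e⟩⟩ := p.prop_diag_obj j
    obtain ⟨l, hl⟩ := h s (e.hom ≫ p.ι.app j)
    exact ⟨e.inv ≫ l, by simp [hl]⟩
  choose l hl using this
  refine ⟨p.isColimit.desc (Cocone.mk _ { app := l, naturality := fun j j' φ ↦ ?_ }),
    p.isColimit.hom_ext fun j ↦ ?_⟩
  · have := p.w φ
    dsimp
    rw [← cancel_mono f]
    simp [hl, reassoc_of% this]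
  · rw [← hl, p.isColimit.fac_assoc]

lemma isIso_of_bijective {X Y : A} (f : X ⟶ Y)
    (h₁ : ∀ (s : S) (x y : i.obj s ⟶ X), x ≫ f = y ≫ f → x = y)
    (h₂ : ∀ (s : S) (y : i.obj s ⟶ Y), ∃ x, x ≫ f = y) : IsIso f := by
  have : Mono f := ⟨fun a b hab ↦ hi.hom_ext fun s x ↦ h₁ _ _ _ (by simp [hab])⟩
  obtain ⟨l, hl⟩ := hi.exists_lift f (𝟙 Y) (fun s x ↦ by simpa using h₂ s x)
  have : IsSplitEpi f := ⟨⟨⟨l, hl⟩⟩⟩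
  exact isIso_of_mono_of_isSplitEpi f

section

variable [i.Full] [i.Faithful] (X : A)

/-- A presentation of `X` by objects of `S` is a functor from its index category to the objects of
`S` over `X`. Presentability makes this functor final, and `κ`-filteredness passes along final
functors. -/
lemma isCardinalFiltered_costructuredArrow :
    IsCardinalFiltered (CostructuredArrow i X) κ := by
  obtain ⟨J, _, _, ⟨p⟩⟩ := hi.exists_colimitsOfShape X
  choose s e using p.prop_diag_obj
  let e (j : J) : i.obj (s j) ≅ p.diag.obj j := (e j).some
  let G : J ⥤ CostructuredArrow i X :=
    { obj j := CostructuredArrow.mk (Y := s j) ((e j).hom ≫ p.ι.app j)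
      map {j j'} φ := CostructuredArrow.homMk (i.preimage ((e j).hom ≫ p.diag.map φ ≫ (e j').inv))
        (by have := p.w φ; simp [this])
      map_id j := by
        ext
        exact i.map_injective (by simp)
      map_comp φ ψ := by
        ext
        exact i.map_injective (by simp) }
  have := isFiltered_of_isCardinalFiltered J κ
  have : G.Final := by
    rw [Functor.final_iff_of_isFiltered]
    refine ⟨fun f ↦ ?_, fun {f j} g₁ g₂ ↦ ?_⟩
    · have := hi.isCardinalPresentable_obj f.left
      obtain ⟨j, g, hg⟩ := IsCardinalPresentable.exists_hom_of_isColimit κ p.isColimit f.hom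
      exact ⟨j, ⟨CostructuredArrow.homMk (i.preimage (g ≫ (e j).inv)) (by simpa [G] using hg)⟩⟩
    · have := hi.isCardinalPresentable_obj f.left
      have h₁ := CostructuredArrow.w g₁
      have h₂ := CostructuredArrow.w g₂
      dsimp [G] at h₁ h₂
      obtain ⟨k, a, h⟩ := IsCardinalPresentable.exists_eq_of_isColimit' κ p.isColimit
        (i.map g₁.left ≫ (e j).hom) (i.map g₂.left ≫ (e j).hom) (by
          simpa using h₁.trans h₂.symm)
      refine ⟨k, a, ?_⟩
      ext
      apply i.map_injective
      simpa [G] using congr($h ≫ (e k).inv)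
  exact IsCardinalFiltered.of_final G κ

end

variable [Preadditive A]

lemma nonempty_isLimit_kernelFork {X Y Z : A} {f : X ⟶ Y} {g : Y ⟶ Z} (h : f ≫ g = 0)
    (h₁ : ∀ (s : S) (x : i.obj s ⟶ X), x ≫ f = 0 → x = 0)
    (h₂ : ∀ (s : S) (y : i.obj s ⟶ Y), y ≫ g = 0 → ∃ x, x ≫ f = y) :
    Nonempty (IsLimit (KernelFork.ofι f h)) := by
  have : Mono f := Preadditive.mono_of_cancel_zero _ fun a ha ↦
    hi.hom_ext fun s x ↦ by rw [comp_zero, h₁ s (x ≫ a) (by simp [ha])]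
  exact (nonempty_isLimit_kernelFork_iff _ _ _).2 ⟨this, fun W k hk ↦
    hi.exists_lift f k fun s x ↦ h₂ s _ (by simp [hk])⟩

/-- A cocone over a `κ`-filtered diagram is a colimit if this can be tested on the generating
objects. -/
lemma nonempty_isColimit {J : Type w} [SmallCategory J] [IsCardinalFiltered J κ] {D : J ⥤ A}
    [HasColimit D] (c : Cocone D)
    (h₁ : ∀ (s : S) (j : J) (x : i.obj s ⟶ D.obj j), x ≫ c.ι.app j = 0 →
      ∃ (j' : J) (φ : j ⟶ j'), x ≫ D.map φ = 0)
    (h₂ : ∀ (s : S) (y : i.obj s ⟶ c.pt), ∃ (j : J) (x : i.obj s ⟶ D.obj j),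
      x ≫ c.ι.app j = y) : Nonempty (IsColimit c) := by
  have : IsIso ((colimit.isColimit D).desc c) := by
    refine hi.isIso_of_bijective _ (fun s x y hxy ↦ ?_) (fun s y ↦ ?_)
    · have := hi.isCardinalPresentable_obj s
      rw [← sub_eq_zero, ← Preadditive.sub_comp] at hxy
      rw [← sub_eq_zero]
      obtain ⟨j, z, hz⟩ := IsCardinalPresentable.exists_hom_of_isColimit κ (colimit.isColimit D)
        (x - y)
      rw [← hz, Category.assoc, IsColimit.fac] at hxy
      obtain ⟨j', φ, hφ⟩ := h₁ s j z hxy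
      rw [← hz, ← (colimit.cocone D).w φ, reassoc_of% hφ, zero_comp]
    · obtain ⟨j, x, hx⟩ := h₂ s y
      exact ⟨x ≫ (colimit.cocone D).ι.app j, by rw [Category.assoc, IsColimit.fac, hx]⟩
  exact ⟨IsColimit.ofPointIso (colimit.isColimit D)⟩

lemma nonempty_isColimit_canonicalCocone [Preadditive S] [i.Full] [i.Faithful] [i.Additive]
    [HasCardinalFilteredColimits A κ] (X : A) :
    Nonempty (IsColimit (canonicalCocone i X)) := by
  have := hi.isCardinalFiltered_costructuredArrow X
  have := isFiltered_of_isCardinalFiltered (CostructuredArrow i X) κ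
  have := HasCardinalFilteredColimits.hasColimitsOfShape A κ (CostructuredArrow i X)
  refine hi.nonempty_isColimit _ (fun s j x hx ↦ ?_) (fun s y ↦
    ⟨CostructuredArrow.mk y, 𝟙 _, Category.id_comp y⟩)
  dsimp at x hx
  -- If `x` dies in `X`, then `x` and `0` are parallel morphisms out of the zero map `i.obj s ⟶ X`;
  -- a morphism coequalizing them in the filtered index category kills `x`.
  let a : CostructuredArrow.mk (0 : i.obj s ⟶ X) ⟶ j :=
    CostructuredArrow.homMk (i.preimage x) ((congrArg (· ≫ j.hom) (i.map_preimage x)).trans hx)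
  let b : CostructuredArrow.mk (0 : i.obj s ⟶ X) ⟶ j := CostructuredArrow.homMk 0 (by simp)
  have ha : i.map a.left = x := i.map_preimage x
  have hb : b.left = 0 := rfl
  have h := congr(i.map (CommaMorphism.left $(IsFiltered.coeq_condition a b)))
  rw [Comma.comp_left, Comma.comp_left, i.map_comp, ha, hb, zero_comp, i.map_zero] at h
  exact ⟨_, IsFiltered.coeqHom a b, h⟩

end CategoryTheory.ObjectProperty.IsCardinalFilteredGenerator

/-! ### Local epimorphisms, and `κ`-filtered colimits of kernels. -/

section

variable {S : Type w} [SmallCategory S] [Preadditive S] {A : Type u} [Category.{w} A]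

section

variable {C : Type*} [Category* C] [HasZeroMorphisms C] {J : Type*} [Category* J]
  {D : J ⥤ ShortComplex C} (c : Cocone D) (j : J)

lemma shortComplexCocone_comm₁₂ :
    (c.ι.app j).τ₁ ≫ c.pt.f = (D.obj j).f ≫ (c.ι.app j).τ₂ :=
  (c.ι.app j).comm₁₂

lemma shortComplexCocone_comm₂₃ :
    (c.ι.app j).τ₂ ≫ c.pt.g = (D.obj j).g ≫ (c.ι.app j).τ₃ :=
  (c.ι.app j).comm₂₃

end

namespace QuillenExactStructure

variable (E : QuillenExactStructure S) (i : S ⥤ A)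

/-- A morphism `g : Y ⟶ Z` is a local epimorphism if any morphism to `Z` from an object coming
from `S` lifts to `Y` after precomposition with an admissible epimorphism in `S`. -/
def IsLocalEpi {Y Z : A} (g : Y ⟶ Z) : Prop :=
  ∀ ⦃T : S⦄ (t : i.obj T ⟶ Z), ∃ (T' : S) (p : T' ⟶ T) (u : i.obj T' ⟶ Y),
    IsAdmissibleEpi E.shortExact p ∧ u ≫ g = i.map p ≫ t

variable {E i}

lemma IsLocalEpi.comp {X Y Z : A} {f : X ⟶ Y} {g : Y ⟶ Z} (hf : E.IsLocalEpi i f)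
    (hg : E.IsLocalEpi i g) : E.IsLocalEpi i (f ≫ g) := by
  intro T t
  obtain ⟨T', p, u, hp, hu⟩ := hg t
  obtain ⟨T'', p', u', hp', hu'⟩ := hf u
  exact ⟨T'', p' ≫ p, u', E.admissibleEpi_comp _ _ hp' hp, by
    rw [reassoc_of% hu', hu, i.map_comp, Category.assoc]⟩

lemma IsLocalEpi.of_comp {X Y Z : A} {f : X ⟶ Y} {g : Y ⟶ Z} (h : E.IsLocalEpi i (f ≫ g)) :
    E.IsLocalEpi i g := by
  intro T t
  obtain ⟨T', p, u, hp, hu⟩ := h t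
  exact ⟨T', p, u ≫ f, hp, by rw [Category.assoc, hu]⟩

lemma IsLocalEpi.of_isSplitEpi {X Y : A} (f : X ⟶ Y) [IsSplitEpi f] : E.IsLocalEpi i f :=
  fun T t ↦ ⟨T, 𝟙 T, t ≫ section_ f, E.admissibleEpi_id T, by simp⟩

lemma IsLocalEpi.map [i.Full] {Y Z : S} {p : Y ⟶ Z} (hp : IsAdmissibleEpi E.shortExact p) :
    E.IsLocalEpi i (i.map p) := by
  intro T t
  obtain ⟨P, q, c', sq, hq⟩ := E.exists_pullback p (i.preimage t) hp
  exact ⟨P, q, i.map c', hq, by rw [← i.map_comp, ← sq.w, i.map_comp, i.map_preimage]⟩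

variable [Preadditive A]

variable (E i) in
/-- The three-term complexes which consist of a local epimorphism and its kernel. -/
def locallyExact : ObjectProperty (ShortComplex A) := fun X ↦
  Nonempty (IsLimit (KernelFork.ofι X.f X.zero)) ∧ E.IsLocalEpi i X.g

lemma locallyExact_of_iso {X Y : ShortComplex A} (e : X ≅ Y) (hX : E.locallyExact i X) :
    E.locallyExact i Y := by
  obtain ⟨⟨_, h₁⟩, h₂⟩ := hX.imp_left (nonempty_isLimit_kernelFork_iff _ _ _).1
  have hf : Y.f = e.inv.τ₁ ≫ X.f ≫ e.hom.τ₂ := by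
    rw [e.inv.comm₁₂_assoc, ← ShortComplex.comp_τ₂, e.inv_hom_id, ShortComplex.id_τ₂,
      Category.comp_id]
  have hg : Y.g = e.inv.τ₂ ≫ X.g ≫ e.hom.τ₃ := by
    rw [e.inv.comm₂₃_assoc, ← ShortComplex.comp_τ₃, e.inv_hom_id, ShortComplex.id_τ₃,
      Category.comp_id]
  refine ⟨(nonempty_isLimit_kernelFork_iff _ _ _).2 ⟨by rw [hf]; infer_instance,
    fun W k hk ↦ ?_⟩, ?_⟩
  · obtain ⟨l, hl⟩ := h₁ (k ≫ e.inv.τ₂) (by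
      rw [Category.assoc, e.inv.comm₂₃, reassoc_of% hk, zero_comp])
    refine ⟨l ≫ e.hom.τ₁, ?_⟩
    rw [Category.assoc, e.hom.comm₁₂, reassoc_of% hl, ← ShortComplex.comp_τ₂, e.inv_hom_id,
      ShortComplex.id_τ₂, Category.comp_id]
  · rw [hg]
    exact (IsLocalEpi.of_isSplitEpi _).comp (h₂.comp (IsLocalEpi.of_isSplitEpi _))

end QuillenExactStructure

variable [Preadditive A] {i : S ⥤ A} {κ : Cardinal.{w}} [Fact κ.IsRegular]
  (hi : i.essImage.IsCardinalFilteredGenerator κ)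

namespace CategoryTheory.ObjectProperty.IsCardinalFilteredGenerator

include hi

omit [Preadditive S] in
/-- `κ`-filtered colimits preserve kernels. -/
lemma nonempty_isLimit_of_isColimit {J : Type w} [SmallCategory J] [IsCardinalFiltered J κ]
    {D : J ⥤ ShortComplex A} (c : Cocone D)
    (h₁ : IsColimit (ShortComplex.π₁.mapCocone c))
    (h₂ : IsColimit (ShortComplex.π₂.mapCocone c))
    (h₃ : IsColimit (ShortComplex.π₃.mapCocone c))
    (hD : ∀ j, Nonempty (IsLimit (KernelFork.ofι (D.obj j).f (D.obj j).zero))) :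
    Nonempty (IsLimit (KernelFork.ofι c.pt.f c.pt.zero)) := by
  simp only [nonempty_isLimit_kernelFork_iff] at hD
  refine hi.nonempty_isLimit_kernelFork _ (fun s x hx ↦ ?_) (fun s y hy ↦ ?_)
  · have := hi.isCardinalPresentable_obj s
    obtain ⟨j, (z : i.obj s ⟶ (D.obj j).X₁), (hz : z ≫ (c.ι.app j).τ₁ = x)⟩ :=
      IsCardinalPresentable.exists_hom_of_isColimit κ h₁ x
    obtain ⟨j', φ, (hφ : (z ≫ (D.obj j).f) ≫ (D.map φ).τ₂ = 0 ≫ (D.map φ).τ₂)⟩ :=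
      IsCardinalPresentable.exists_eq_of_isColimit' κ h₂ (i := j) (z ≫ (D.obj j).f) 0 (by
        have : (z ≫ (D.obj j).f) ≫ (c.ι.app j).τ₂ = 0 ≫ (c.ι.app j).τ₂ := by
          rw [Category.assoc, ← shortComplexCocone_comm₁₂, reassoc_of% hz, hx, zero_comp]
        exact this)
    have := (hD j').1
    have h : z ≫ (D.map φ).τ₁ = 0 := by
      rw [← cancel_mono (D.obj j').f, Category.assoc, (D.map φ).comm₁₂, zero_comp,
        ← Category.assoc, hφ, zero_comp]
    rw [← hz, ← c.w φ, ShortComplex.comp_τ₁, reassoc_of% h, zero_comp]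
  · have := hi.isCardinalPresentable_obj s
    obtain ⟨j, (z : i.obj s ⟶ (D.obj j).X₂), (hz : z ≫ (c.ι.app j).τ₂ = y)⟩ :=
      IsCardinalPresentable.exists_hom_of_isColimit κ h₂ y
    obtain ⟨j', φ, (hφ : (z ≫ (D.obj j).g) ≫ (D.map φ).τ₃ = 0 ≫ (D.map φ).τ₃)⟩ :=
      IsCardinalPresentable.exists_eq_of_isColimit' κ h₃ (i := j) (z ≫ (D.obj j).g) 0 (by
        have : (z ≫ (D.obj j).g) ≫ (c.ι.app j).τ₃ = 0 ≫ (c.ι.app j).τ₃ := by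
          rw [Category.assoc, ← shortComplexCocone_comm₂₃, reassoc_of% hz, hy, zero_comp]
        exact this)
    obtain ⟨l, hl⟩ := (hD j').2 (z ≫ (D.map φ).τ₂) (by
      rw [Category.assoc, (D.map φ).comm₂₃, ← Category.assoc, hφ, zero_comp])
    refine ⟨l ≫ (c.ι.app j').τ₁, ?_⟩
    rw [Category.assoc, shortComplexCocone_comm₁₂, reassoc_of% hl, ← ShortComplex.comp_τ₂, c.w, hz]

/-- A test map from a presentable object factors through one stage and can be lifted there. -/
lemma isLocalEpi_of_isColimit {E : QuillenExactStructure S} {J : Type w} [SmallCategory J]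
    [IsCardinalFiltered J κ] {D : J ⥤ ShortComplex A} (c : Cocone D)
    (h₃ : IsColimit (ShortComplex.π₃.mapCocone c))
    (hD : ∀ j, E.IsLocalEpi i (D.obj j).g) : E.IsLocalEpi i c.pt.g := by
  intro T t
  have := hi.isCardinalPresentable_obj T
  obtain ⟨j, (z : i.obj T ⟶ (D.obj j).X₃), (hz : z ≫ (c.ι.app j).τ₃ = t)⟩ :=
    IsCardinalPresentable.exists_hom_of_isColimit κ h₃ t
  obtain ⟨T', p, u, hp, hu⟩ := hD j z
  refine ⟨T', p, u ≫ (c.ι.app j).τ₂, hp, ?_⟩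
  rw [Category.assoc, shortComplexCocone_comm₂₃, reassoc_of% hu, hz]

variable [i.Full] [i.Faithful]

/-- The inclusion of a `κ`-filtered generator preserves cokernels. -/
lemma nonempty_isColimit_cokernelCofork_map [i.Additive] {X Y Z : S} {f : X ⟶ Y} {g : Y ⟶ Z}
    (h : f ≫ g = 0) (hc : Nonempty (IsColimit (CokernelCofork.ofπ g h)))
    (h' : i.map f ≫ i.map g = 0) :
    Nonempty (IsColimit (CokernelCofork.ofπ (i.map g) h')) := by
  obtain ⟨_, hd⟩ := (nonempty_isColimit_cokernelCofork_iff _ _ _).1 hc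
  have hX := hi.isCardinalPresentable_obj X
  have hY := hi.isCardinalPresentable_obj Y
  have hZ := hi.isCardinalPresentable_obj Z
  refine (nonempty_isColimit_cokernelCofork_iff _ _ _).2
    ⟨Preadditive.epi_of_cancel_zero _ fun {W} k hk ↦ ?_, fun W k hk ↦ ?_⟩
  -- Present `W` by objects of `S`. By presentability the test map, and the equation it satisfies,
  -- already live at one stage, where the cokernel property in `S` applies; likewise in the second
  -- half.
  · obtain ⟨J, _, _, ⟨p⟩⟩ := hi.exists_colimitsOfShape W
    obtain ⟨j, z, hz⟩ := IsCardinalPresentable.exists_hom_of_isColimit κ p.isColimit k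
    obtain ⟨j', φ, hφ⟩ := IsCardinalPresentable.exists_eq_of_isColimit' κ p.isColimit
      (i.map g ≫ z) 0 (by rw [Category.assoc, hz, hk, zero_comp])
    obtain ⟨s, ⟨e⟩⟩ := p.prop_diag_obj j'
    have h₁ : i.preimage (z ≫ p.diag.map φ ≫ e.inv) = 0 := by
      rw [← cancel_epi g, comp_zero]
      apply i.map_injective
      simpa using congr($hφ ≫ e.inv)
    have h₂ : z ≫ p.diag.map φ = 0 := by
      simpa using congr(i.map $h₁ ≫ e.hom)
    have := p.w φ
    rw [← hz, ← p.w φ, reassoc_of% h₂, zero_comp]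
  · obtain ⟨J, _, _, ⟨p⟩⟩ := hi.exists_colimitsOfShape W
    obtain ⟨j, z, hz⟩ := IsCardinalPresentable.exists_hom_of_isColimit κ p.isColimit k
    obtain ⟨j', φ, hφ⟩ := IsCardinalPresentable.exists_eq_of_isColimit' κ p.isColimit
      (i.map f ≫ z) 0 (by rw [Category.assoc, hz, hk, zero_comp])
    obtain ⟨s, ⟨e⟩⟩ := p.prop_diag_obj j'
    obtain ⟨l, hl⟩ := hd (i.preimage (z ≫ p.diag.map φ ≫ e.inv)) (by
      apply i.map_injective
      simpa using congr($hφ ≫ e.inv))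
    refine ⟨i.map l ≫ e.hom ≫ p.ι.app j', ?_⟩
    rw [← i.map_comp_assoc, hl]
    simp [hz]

lemma isKernelCokernelPair_map [i.Additive] {T : ShortComplex S} (hT : IsKernelCokernelPair T) :
    IsKernelCokernelPair (T.map i) := by
  have := hT.mono
  have w : i.map T.f ≫ i.map T.g = 0 := by rw [← i.map_comp, T.zero, i.map_zero]
  suffices IsKernelCokernelPair (ShortComplex.mk _ _ w) from this
  refine ⟨hi.nonempty_isLimit_kernelFork _ (fun s x hx ↦ ?_) (fun s y hy ↦ ?_),
    hi.nonempty_isColimit_cokernelCofork_map T.zero hT.2 _⟩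
  · have h : i.preimage x = 0 := by
      rw [← cancel_mono T.f, zero_comp]
      exact i.map_injective (by simpa using hx)
    simpa using congr(i.map $h)
  · obtain ⟨l, hl⟩ := hT.exists_lift (i.preimage y) (i.map_injective (by simpa using hy))
    exact ⟨i.map l, by simp [← i.map_comp, hl]⟩

end CategoryTheory.ObjectProperty.IsCardinalFilteredGenerator

end

/-! ### Presenting a local epimorphism by the short exact sequences over it. -/

section

variable {S : Type w} [SmallCategory S] [Preadditive S] {A : Type u} [Category.{w} A]
  {i : S ⥤ A} {κ : Cardinal.{w}} [Fact κ.IsRegular]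

namespace QuillenExactStructure

variable (E : QuillenExactStructure S) (i : S ⥤ A)

/-- The admissible short exact sequences in `S` together with a morphism from
their second morphism to a given morphism `g`. -/
structure ShortExactOver {Y Z : A} (g : Y ⟶ Z) : Type w where
  /-- The short exact sequence. -/
  seq : ShortComplex S
  shortExact : E.shortExact seq
  /-- The morphism from the second term. -/
  toY : i.obj seq.X₂ ⟶ Y
  /-- The morphism from the third term. -/
  toZ : i.obj seq.X₃ ⟶ Z
  w : toY ≫ g = i.map seq.g ≫ toZ

namespace ShortExactOver

variable {E i} {Y Z : A} {g : Y ⟶ Z}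

/-- Morphisms of short exact sequences over `g`. -/
@[ext]
structure Hom (c d : E.ShortExactOver i g) where
  /-- The morphism of short exact sequences. -/
  hom : c.seq ⟶ d.seq
  w₂ : i.map hom.τ₂ ≫ d.toY = c.toY
  w₃ : i.map hom.τ₃ ≫ d.toZ = c.toZ

@[simps]
instance : SmallCategory (E.ShortExactOver i g) where
  Hom := Hom
  id c := { hom := 𝟙 _, w₂ := by simp, w₃ := by simp }
  comp φ ψ :=
    { hom := φ.hom ≫ ψ.hom
      w₂ := by rw [ShortComplex.comp_τ₂, i.map_comp, Category.assoc, ψ.w₂, φ.w₂]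
      w₃ := by rw [ShortComplex.comp_τ₃, i.map_comp, Category.assoc, ψ.w₃, φ.w₃] }

@[ext]
lemma hom_ext {c d : E.ShortExactOver i g} {φ ψ : c ⟶ d} (h : φ.hom = ψ.hom) : φ = ψ :=
  Hom.ext h

variable (E i g) in
/-- The functor to the category of morphisms in `S` over `g`. -/
@[simps]
def toComma : E.ShortExactOver i g ⥤
    Comma (CostructuredArrow.map (S := i) g) (𝟭 (CostructuredArrow i Z)) where
  obj c :=
    { left := CostructuredArrow.mk c.toY
      right := CostructuredArrow.mk c.toZ
      hom := CostructuredArrow.homMk c.seq.g c.w.symm }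
  map {c d} φ :=
    { left := CostructuredArrow.homMk φ.hom.τ₂ φ.w₂
      right := CostructuredArrow.homMk φ.hom.τ₃ φ.w₃
      w := by
        ext
        exact φ.hom.comm₂₃ }

/-- The first term of a short exact sequence is a kernel, so morphisms of sequences are determined
by their last two components; fullness below has the same reason. -/
instance : (toComma E i g).Faithful where
  map_injective {c d φ ψ} h := by
    have h₂ : φ.hom.τ₂ = ψ.hom.τ₂ :=
      congr_arg (fun α ↦ α.left.left) h
    have h₃ : φ.hom.τ₃ = ψ.hom.τ₃ :=
      congr_arg (fun α ↦ α.right.left) h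
    have := (E.isKernelCokernelPair d.shortExact).mono
    have h₁ : φ.hom.τ₁ = ψ.hom.τ₁ := by
      rw [← cancel_mono d.seq.f, φ.hom.comm₁₂, ψ.hom.comm₁₂, h₂]
    exact hom_ext (ShortComplex.hom_ext _ _ h₁ h₂ h₃)

instance : (toComma E i g).Full where
  map_surjective {c d} α := by
    let u : c.seq.X₂ ⟶ d.seq.X₂ := α.left.left
    let v : c.seq.X₃ ⟶ d.seq.X₃ := α.right.left
    have huv : u ≫ d.seq.g = c.seq.g ≫ v := congr_arg CommaMorphism.left α.w
    have hu : i.map u ≫ d.toY = c.toY := CostructuredArrow.w α.left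
    have hv : i.map v ≫ d.toZ = c.toZ := CostructuredArrow.w α.right
    obtain ⟨t, ht⟩ := (E.isKernelCokernelPair d.shortExact).exists_lift (c.seq.f ≫ u) (by
      rw [Category.assoc, huv, c.seq.zero_assoc, zero_comp])
    refine ⟨⟨{ τ₁ := t, τ₂ := u, τ₃ := v, comm₁₂ := ht, comm₂₃ := huv }, hu, hv⟩, ?_⟩
    ext <;> rfl

variable [Preadditive A] [i.Additive] [HasZeroObject S] [HasBinaryBiproducts S]

/-- Given `u` over `g`, cover its target by an admissible epimorphism `p` from `T` that lifts to
`Y`. Then `(u, p)` is an admissible epimorphism over `g`, and `u` maps to it through the first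
summand. -/
lemma exists_hom_toComma (hg : E.IsLocalEpi i g)
    (k : Comma (CostructuredArrow.map (S := i) g) (𝟭 (CostructuredArrow i Z))) :
    ∃ c, Nonempty (k ⟶ (toComma E i g).obj c) := by
  let t₂ : i.obj k.left.left ⟶ Y := k.left.hom
  let t₃ : i.obj k.right.left ⟶ Z := k.right.hom
  let u : k.left.left ⟶ k.right.left := k.hom.left
  have hu : i.map u ≫ t₃ = t₂ ≫ g := CostructuredArrow.w k.hom
  obtain ⟨T, p, y, hp, hy⟩ := hg t₃
  obtain ⟨K, f, h, hK⟩ := E.admissibleEpi_biprod_desc u hp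
  refine ⟨⟨_, hK, (i.map biprod.fst ≫ t₂ + i.map biprod.snd ≫ y), t₃, ?_⟩, ⟨?_⟩⟩
  · dsimp
    rw [biprod.desc_eq, i.map_add, Preadditive.add_comp, Preadditive.add_comp, i.map_comp,
      i.map_comp, Category.assoc, Category.assoc, Category.assoc, Category.assoc, hu, hy]
  · exact
      { left := CostructuredArrow.homMk biprod.inl (by
          have : i.map (biprod.inl : k.left.left ⟶ _ ⊞ T) ≫
              (i.map biprod.fst ≫ t₂ + i.map biprod.snd ≫ y) = t₂ := by
            rw [Preadditive.comp_add, ← i.map_comp_assoc, ← i.map_comp_assoc, biprod.inl_fst,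
              biprod.inl_snd, i.map_id, i.map_zero, zero_comp, add_zero, Category.id_comp]
          exact this)
        right := CostructuredArrow.homMk (𝟙 _) (by
          have : i.map (𝟙 k.right.left) ≫ t₃ = t₃ := by simp
          exact this)
        w := by
          ext
          have : biprod.inl ≫ biprod.desc u p = u ≫ 𝟙 _ := by simp
          exact this }

/-- The diagram of short exact sequences over `g`. -/
@[simps]
def diag : E.ShortExactOver i g ⥤ ShortComplex A where
  obj c := c.seq.map i
  map φ := i.mapShortComplex.map φ.hom

section

variable [i.Full] [i.Faithful] [HasCardinalFilteredColimits A κ]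
  (hi : i.essImage.IsCardinalFilteredGenerator κ) (hg : E.IsLocalEpi i g)

include hi hg

omit [HasCardinalFilteredColimits A κ] in
lemma isCardinalFiltered : IsCardinalFiltered (E.ShortExactOver i g) κ := by
  have := hi.isCardinalFiltered_costructuredArrow Y
  have := hi.isCardinalFiltered_costructuredArrow Z
  have := isCardinalFiltered_comma_id (CostructuredArrow.map (S := i) g) κ
  exact isCardinalFiltered_of_full_of_faithful (toComma E i g) κ (exists_hom_toComma hg)

omit [HasCardinalFilteredColimits A κ] in
-- Together with `final_snd`, this identifies the colimits of the second and third terms with the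
-- canonical colimits `Y` and `Z`.
lemma final_fst : (toComma E i g ⋙ Comma.fst _ _).Final := by
  have := hi.isCardinalFiltered_costructuredArrow Y
  have := hi.isCardinalFiltered_costructuredArrow Z
  have := isFiltered_of_isCardinalFiltered (CostructuredArrow i Y) κ
  have := isFiltered_of_isCardinalFiltered (CostructuredArrow i Z) κ
  have := Functor.final_of_exists_of_isFiltered_of_fullyFaithful _ (exists_hom_toComma hg)
  infer_instance

omit [HasCardinalFilteredColimits A κ] in
lemma final_snd : (toComma E i g ⋙ Comma.snd _ _).Final := by
  have := hi.isCardinalFiltered_costructuredArrow Y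
  have := hi.isCardinalFiltered_costructuredArrow Z
  have := isFiltered_of_isCardinalFiltered (CostructuredArrow i Y) κ
  have := isFiltered_of_isCardinalFiltered (CostructuredArrow i Z) κ
  have := Functor.final_of_exists_of_isFiltered_of_fullyFaithful _ (exists_hom_toComma hg)
  infer_instance

omit hi hg [HasCardinalFilteredColimits A κ] [HasZeroObject S] [HasBinaryBiproducts S] [i.Full]
  [i.Faithful] in
variable (E i) in
/-- The cocone over the diagram of short exact sequences over `g` given by compatible morphisms
from their first terms. -/
def cocone {X : A} (f : X ⟶ Y) (h : f ≫ g = 0)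
    (x : ∀ c : E.ShortExactOver i g, i.obj c.seq.X₁ ⟶ X)
    (hx : ∀ c, x c ≫ f = i.map c.seq.f ≫ c.toY)
    (hx' : ∀ {c d : E.ShortExactOver i g} (φ : c ⟶ d), i.map φ.hom.τ₁ ≫ x d = x c) :
    Cocone (diag (E := E) (i := i) (g := g)) where
  pt := ShortComplex.mk f g h
  ι :=
    { app c :=
        { τ₁ := x c
          τ₂ := c.toY
          τ₃ := c.toZ
          comm₁₂ := hx c
          comm₂₃ := c.w }
      naturality _ _ φ := ShortComplex.hom_ext _ _
        ((hx' φ).trans (Category.comp_id _).symm) (φ.w₂.trans (Category.comp_id _).symm)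
        (φ.w₃.trans (Category.comp_id _).symm) }

end

end ShortExactOver

/-- No kernels are assumed in `A`: the kernel is built as the colimit of the first terms of the
sequences over `g`. Their last two terms have colimit `g`, and `κ`-filtered colimits preserve
kernels. -/
lemma IsLocalEpi.exists_kernel [Preadditive A] {E : QuillenExactStructure S} {i : S ⥤ A}
    [i.Additive] [HasZeroObject S] [HasBinaryBiproducts S] [i.Full] [i.Faithful]
    [HasCardinalFilteredColimits A κ] (hi : i.essImage.IsCardinalFilteredGenerator κ) {Y Z : A}
    {g : Y ⟶ Z} (hg : E.IsLocalEpi i g) :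
    ∃ (X : A) (f : X ⟶ Y) (h : f ≫ g = 0), Nonempty (IsLimit (KernelFork.ofι f h)) ∧
      directedColimits (E.shortExact.map i.mapShortComplex) κ (ShortComplex.mk f g h) := by
  have := ShortExactOver.isCardinalFiltered hi hg
  have := ShortExactOver.final_fst hi hg
  have := ShortExactOver.final_snd hi hg
  have := HasCardinalFilteredColimits.hasColimitsOfShape A κ (E.ShortExactOver i g)
  let D := ShortExactOver.diag (E := E) (i := i) (g := g) ⋙ ShortComplex.π₁
  let f : colimit D ⟶ Y := colimit.desc D
    { pt := Y
      ι :=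
        { app c := i.map c.seq.f ≫ c.toY
          naturality c d φ := by
            have h : i.map φ.hom.τ₁ ≫ i.map d.seq.f ≫ d.toY = i.map c.seq.f ≫ c.toY := by
              rw [← i.map_comp_assoc, φ.hom.comm₁₂, i.map_comp_assoc, φ.w₂]
            exact h.trans (Category.comp_id _).symm } }
  have hf (c) : colimit.ι D c ≫ f = i.map c.seq.f ≫ c.toY := colimit.ι_desc _ _
  have h : f ≫ g = 0 := by
    refine colimit.hom_ext fun c ↦ ?_
    have hc : (i.map c.seq.f ≫ c.toY) ≫ g = 0 := by
      rw [Category.assoc, c.w, ← i.map_comp_assoc, c.seq.zero, i.map_zero, zero_comp]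
    exact (Category.assoc _ _ _).symm.trans
      ((congrArg (· ≫ g) (hf c)).trans (hc.trans comp_zero.symm))
  let c := ShortExactOver.cocone E i f h (fun c ↦ colimit.ι D c) hf (fun φ ↦ colimit.w D φ)
  have h₁ : IsColimit (ShortComplex.π₁.mapCocone c) :=
    IsColimit.ofIsoColimit (colimit.isColimit D) (Cocone.ext (Iso.refl _)
      (fun j ↦ Category.comp_id _))
  have h₂ : IsColimit (ShortComplex.π₂.mapCocone c) :=
    (Functor.Final.isColimitWhiskerEquiv (ShortExactOver.toComma E i g ⋙ Comma.fst _ _) _).symm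
      (hi.nonempty_isColimit_canonicalCocone Y).some
  have h₃ : IsColimit (ShortComplex.π₃.mapCocone c) :=
    (Functor.Final.isColimitWhiskerEquiv (ShortExactOver.toComma E i g ⋙ Comma.snd _ _) _).symm
      (hi.nonempty_isColimit_canonicalCocone Z).some
  refine ⟨_, f, h, ?_, E.ShortExactOver i g, inferInstance, inferInstance, ⟨{
    diag := ShortExactOver.diag (E := E) (i := i) (g := g)
    ι := c.ι
    isColimit := ShortComplex.isColimitOfIsColimitπ c h₁ h₂ h₃
    prop_diag_obj d := ObjectProperty.prop_map_obj _ _ d.shortExact }⟩⟩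
  exact hi.nonempty_isLimit_of_isColimit c h₁ h₂ h₃
    fun d ↦ (hi.isKernelCokernelPair_map (E.isKernelCokernelPair d.shortExact)).1

end QuillenExactStructure

end

/-! ### Colimits of cokernels and of pushouts. -/

section

variable {C : Type u} [Category.{v} C] [Preadditive C]

/-- Colimits preserve cokernels. -/
lemma nonempty_isColimit_cokernelCofork_of_isColimit {J : Type*} [Category* J]
    {D : J ⥤ ShortComplex C} (c : Cocone D)
    (h₂ : IsColimit (ShortComplex.π₂.mapCocone c))
    (h₃ : IsColimit (ShortComplex.π₃.mapCocone c))
    (hD : ∀ j, Nonempty (IsColimit (CokernelCofork.ofπ (D.obj j).g (D.obj j).zero))) :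
    Nonempty (IsColimit (CokernelCofork.ofπ c.pt.g c.pt.zero)) := by
  simp only [nonempty_isColimit_cokernelCofork_iff] at hD ⊢
  refine ⟨Preadditive.epi_of_cancel_zero _ fun {W} k hk ↦ h₃.hom_ext fun j ↦ ?_, fun W k hk ↦ ?_⟩
  · have := (hD j).1
    have h : (c.ι.app j).τ₃ ≫ k = (c.ι.app j).τ₃ ≫ 0 := by
      rw [← cancel_epi (D.obj j).g, ← Category.assoc, ← shortComplexCocone_comm₂₃, Category.assoc,
        hk, comp_zero, comp_zero, comp_zero]
    exact h
  · have hl (j : J) : ∃ l, (D.obj j).g ≫ l = (c.ι.app j).τ₂ ≫ k := (hD j).2 _ (by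
      rw [← Category.assoc, ← shortComplexCocone_comm₁₂, Category.assoc, hk, comp_zero])
    choose l hl using hl
    let s : Cocone (D ⋙ ShortComplex.π₃) :=
      { pt := W
        ι :=
          { app := l
            naturality j j' φ := by
              have := (hD j).1
              have h : (D.map φ).τ₃ ≫ l j' = l j := by
                rw [← cancel_epi (D.obj j).g, hl, ← (D.map φ).comm₂₃_assoc, hl,
                  ← ShortComplex.comp_τ₂_assoc, c.w]
              exact h.trans (Category.comp_id _).symm } }
    let d : c.pt.X₃ ⟶ W := h₃.desc s
    refine ⟨d, h₂.hom_ext fun j ↦ ?_⟩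
    have h : (c.ι.app j).τ₃ ≫ d = l j := h₃.fac s j
    have h' : (c.ι.app j).τ₂ ≫ c.pt.g ≫ d = (c.ι.app j).τ₂ ≫ k := by
      rw [← Category.assoc, shortComplexCocone_comm₂₃, Category.assoc, h, hl]
    exact h'

open ShortComplex in
/-- Pushouts of a colimit of three-term complexes are colimits of pushouts. -/
lemma exists_pushout_of_isColimit (κ : Cardinal.{w}) [Fact κ.IsRegular] {M : Type w}
    [SmallCategory M] [IsCardinalFiltered M κ] [HasColimitsOfShape M C] {D : M ⥤ ShortComplex C}
    {c : Cocone D} (h₁ : IsColimit (π₁.mapCocone c)) (h₂ : IsColimit (π₂.mapCocone c))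
    (h₃ : IsColimit (π₃.mapCocone c)) {D' : M ⥤ C} {c' : Cocone D'} (h' : IsColimit c')
    (β : ∀ m, (D.obj m).X₁ ⟶ D'.obj m)
    (hβ : ∀ {m n} (φ : m ⟶ n), β m ≫ D'.map φ = (D.map φ).τ₁ ≫ β n)
    (a : c.pt.X₁ ⟶ c'.pt) (ha : ∀ m, (c.ι.app m).τ₁ ≫ a = β m ≫ c'.ι.app m)
    (Q : ObjectProperty (ShortComplex C))
    (hQ : ∀ m, ∃ (P : C) (a' : (D.obj m).X₂ ⟶ P) (f' : D'.obj m ⟶ P) (g' : P ⟶ (D.obj m).X₃)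
      (w : f' ≫ g' = 0), IsPushout (D.obj m).f (β m) a' f' ∧ a' ≫ g' = (D.obj m).g ∧
        Q (ShortComplex.mk f' g' w)) :
    ∃ (P : C) (a' : c.pt.X₂ ⟶ P) (f' : c'.pt ⟶ P) (g' : P ⟶ c.pt.X₃) (w : f' ≫ g' = 0),
      IsPushout c.pt.f a a' f' ∧ a' ≫ g' = c.pt.g ∧
        directedColimits Q κ (ShortComplex.mk f' g' w) := by
  choose P a' f' g' w sq hg' hQ using hQ
  let p {m n : M} (φ : m ⟶ n) : P m ⟶ P n :=
    (sq m).desc ((D.map φ).τ₂ ≫ a' n) (D'.map φ ≫ f' n) (by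
      rw [← (D.map φ).comm₁₂_assoc, (sq n).w, reassoc_of% hβ φ])
  have hp₁ {m n : M} (φ : m ⟶ n) : a' m ≫ p φ = (D.map φ).τ₂ ≫ a' n := (sq m).inl_desc _ _ _
  have hp₂ {m n : M} (φ : m ⟶ n) : f' m ≫ p φ = D'.map φ ≫ f' n := (sq m).inr_desc _ _ _
  have hp₃ {m n : M} (φ : m ⟶ n) : p φ ≫ g' n = g' m ≫ (D.map φ).τ₃ := by
    apply (sq m).hom_ext
    · rw [reassoc_of% hp₁ φ, hg', reassoc_of% hg', (D.map φ).comm₂₃]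
    · rw [reassoc_of% hp₂ φ, w, reassoc_of% w, comp_zero, zero_comp]
  let E : M ⥤ ShortComplex C :=
    { obj m := ShortComplex.mk (f' m) (g' m) (w m)
      map {m n} φ :=
        { τ₁ := D'.map φ
          τ₂ := p φ
          τ₃ := (D.map φ).τ₃
          comm₁₂ := (hp₂ φ).symm
          comm₂₃ := hp₃ φ }
      map_id m := by
        ext
        · exact D'.map_id m
        · apply (sq m).hom_ext
          · rw [hp₁, D.map_id, id_τ₂, Category.id_comp]
            exact (Category.comp_id _).symm
          · rw [hp₂, D'.map_id, Category.id_comp]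
            exact (Category.comp_id _).symm
        · dsimp
          rw [D.map_id, id_τ₃]
      map_comp {m n k} φ ψ := by
        ext
        · exact D'.map_comp φ ψ
        · apply (sq m).hom_ext
          · have : a' m ≫ p (φ ≫ ψ) = a' m ≫ p φ ≫ p ψ := by
              rw [hp₁, D.map_comp, comp_τ₂, reassoc_of% hp₁ φ, hp₁, Category.assoc]
            exact this
          · have : f' m ≫ p (φ ≫ ψ) = f' m ≫ p φ ≫ p ψ := by
              rw [hp₂, D'.map_comp, reassoc_of% hp₂ φ, hp₂, Category.assoc]
            exact this
        · dsimp
          rw [D.map_comp, comp_τ₃] }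
  let L := colimit (E ⋙ π₂)
  let ι (m : M) : P m ⟶ L := colimit.ι (E ⋙ π₂) m
  have hι {m n : M} (φ : m ⟶ n) : p φ ≫ ι n = ι m := colimit.w (E ⋙ π₂) φ
  have hc₁ {m n : M} (φ : m ⟶ n) : (D.map φ).τ₁ ≫ (c.ι.app n).τ₁ = (c.ι.app m).τ₁ := by
    rw [← comp_τ₁, c.w]
  have hc₂ {m n : M} (φ : m ⟶ n) : (D.map φ).τ₂ ≫ (c.ι.app n).τ₂ = (c.ι.app m).τ₂ := by
    rw [← comp_τ₂, c.w]
  have hc₃ {m n : M} (φ : m ⟶ n) : (D.map φ).τ₃ ≫ (c.ι.app n).τ₃ = (c.ι.app m).τ₃ := by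
    rw [← comp_τ₃, c.w]
  have hc' {m n : M} (φ : m ⟶ n) : D'.map φ ≫ c'.ι.app n = c'.ι.app m := c'.w φ
  -- The universal properties of the colimits in stagewise form, so that the remaining constructions
  -- and identities reduce to the pushouts `sq m`.
  have hL {W : C} (l : ∀ m, P m ⟶ W) (hl : ∀ {m n} (φ : m ⟶ n), p φ ≫ l n = l m) :
      ∃ x : L ⟶ W, ∀ m, ι m ≫ x = l m :=
    ⟨colimit.desc (E ⋙ π₂)
      { pt := W, ι := { app := l, naturality m n φ := (hl φ).trans (Category.comp_id _).symm } },
      fun m ↦ colimit.ι_desc _ _⟩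
  have hX {W : C} (l : ∀ m, D'.obj m ⟶ W) (hl : ∀ {m n} (φ : m ⟶ n), D'.map φ ≫ l n = l m) :
      ∃ x : c'.pt ⟶ W, ∀ m, c'.ι.app m ≫ x = l m :=
    ⟨h'.desc
      { pt := W, ι := { app := l, naturality m n φ := (hl φ).trans (Category.comp_id _).symm } },
      fun m ↦ h'.fac _ _⟩
  have hY {W : C} (l : ∀ m, (D.obj m).X₂ ⟶ W)
      (hl : ∀ {m n} (φ : m ⟶ n), (D.map φ).τ₂ ≫ l n = l m) :
      ∃ x : c.pt.X₂ ⟶ W, ∀ m, (c.ι.app m).τ₂ ≫ x = l m :=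
    ⟨h₂.desc
      { pt := W, ι := { app := l, naturality m n φ := (hl φ).trans (Category.comp_id _).symm } },
      fun m ↦ h₂.fac _ _⟩
  have eL {W : C} {x y : L ⟶ W} (h : ∀ m, ι m ≫ x = ι m ≫ y) : x = y := colimit.hom_ext h
  have eX {W : C} {x y : c'.pt ⟶ W} (h : ∀ m, c'.ι.app m ≫ x = c'.ι.app m ≫ y) : x = y :=
    h'.hom_ext h
  have e₁ {W : C} {x y : c.pt.X₁ ⟶ W} (h : ∀ m, (c.ι.app m).τ₁ ≫ x = (c.ι.app m).τ₁ ≫ y) :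
      x = y := h₁.hom_ext h
  have e₂ {W : C} {x y : c.pt.X₂ ⟶ W} (h : ∀ m, (c.ι.app m).τ₂ ≫ x = (c.ι.app m).τ₂ ≫ y) :
      x = y := h₂.hom_ext h
  obtain ⟨α, hα⟩ := hY (fun m ↦ a' m ≫ ι m) (fun φ ↦ by rw [← reassoc_of% hp₁ φ, hι])
  obtain ⟨f, hf⟩ := hX (fun m ↦ f' m ≫ ι m) (fun φ ↦ by rw [← reassoc_of% hp₂ φ, hι])
  obtain ⟨g, hg⟩ := hL (W := c.pt.X₃) (fun m ↦ g' m ≫ (c.ι.app m).τ₃) (fun φ ↦ by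
    rw [reassoc_of% hp₃ φ, hc₃])
  have hfg : f ≫ g = 0 := eX fun m ↦ by rw [reassoc_of% hf, hg, reassoc_of% w, zero_comp, comp_zero]
  have sqw : c.pt.f ≫ α = a ≫ f := e₁ fun m ↦ by
    rw [← Category.assoc, shortComplexCocone_comm₁₂, Category.assoc, hα, reassoc_of% (sq m).w,
      reassoc_of% ha, hf]
  refine ⟨L, α, f, g, hfg, isPushout_of_exists sqw (fun W u v huv ↦ ?_) (fun W l hl hl' ↦ ?_), ?_,
    M, inferInstance, inferInstance, ⟨?_⟩⟩
  · have hs (m : M) : (D.obj m).f ≫ (c.ι.app m).τ₂ ≫ u = β m ≫ c'.ι.app m ≫ v := by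
      rw [← Category.assoc, ← shortComplexCocone_comm₁₂, Category.assoc, huv, reassoc_of% ha]
    obtain ⟨l, hl⟩ := hL (fun m ↦ (sq m).desc _ _ (hs m)) (fun {m n} φ ↦ by
      apply (sq m).hom_ext
      · rw [reassoc_of% hp₁ φ, (sq n).inl_desc, (sq m).inl_desc]
        exact (Category.assoc _ _ _).symm.trans (congrArg (· ≫ u) (hc₂ φ))
      · rw [reassoc_of% hp₂ φ, (sq n).inr_desc, (sq m).inr_desc]
        exact (Category.assoc _ _ _).symm.trans (congrArg (· ≫ v) (hc' φ)))
    exact ⟨l, e₂ fun m ↦ by rw [reassoc_of% hα, hl, (sq m).inl_desc],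
      eX fun m ↦ by rw [reassoc_of% hf, hl, (sq m).inr_desc]⟩
  · refine eL fun m ↦ (sq m).hom_ext ?_ ?_
    · rw [← reassoc_of% hα, hl, comp_zero, comp_zero, comp_zero]
    · rw [← reassoc_of% hf, hl', comp_zero, comp_zero, comp_zero]
  · exact e₂ fun m ↦ by rw [reassoc_of% hα, hg, reassoc_of% hg', shortComplexCocone_comm₂₃]
  · let cc : Cocone E :=
      { pt := ShortComplex.mk f g hfg
        ι :=
          { app m :=
              { τ₁ := c'.ι.app m
                τ₂ := ι m
                τ₃ := (c.ι.app m).τ₃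
                comm₁₂ := hf m
                comm₂₃ := hg m }
            naturality m n φ := ShortComplex.hom_ext _ _
              ((hc' φ).trans (Category.comp_id _).symm) ((hι φ).trans (Category.comp_id _).symm)
              ((hc₃ φ).trans (Category.comp_id _).symm) } }
    exact
      { diag := E
        ι := cc.ι
        isColimit := isColimitOfIsColimitπ cc
          (IsColimit.ofIsoColimit h' (Cocone.ext (Iso.refl _) (fun _ ↦ Category.comp_id _)))
          (IsColimit.ofIsoColimit (colimit.isColimit _)
            (Cocone.ext (Iso.refl _) (fun _ ↦ Category.comp_id _)))
          (IsColimit.ofIsoColimit h₃ (Cocone.ext (Iso.refl _) (fun _ ↦ Category.comp_id _)))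
        prop_diag_obj := hQ }

end

/-! ### Basic properties of directed colimits of three-term complexes. -/

section

variable {C : Type u} [Category.{v} C] {κ : Cardinal.{w}} [Fact κ.IsRegular]

lemma directedColimits_of_iso {P : ObjectProperty C} {X Y : C} (e : X ≅ Y)
    (hX : directedColimits P κ X) : directedColimits P κ Y := by
  obtain ⟨J, _, _, h⟩ := hX
  exact ⟨J, inferInstance, inferInstance, (P.colimitsOfShape J).prop_of_iso e h⟩

lemma directedColimits_monotone {P Q : ObjectProperty C} (h : P ≤ Q) :
    directedColimits P κ ≤ directedColimits Q κ := by
  rintro X ⟨J, _, _, hX⟩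
  exact ⟨J, inferInstance, inferInstance, ObjectProperty.colimitsOfShape_monotone J h _ hX⟩

/-- Directed colimits in the category of three-term complexes can be computed termwise. -/
lemma exists_of_directedColimits_shortComplex [HasZeroMorphisms C]
    [HasCardinalFilteredColimits C κ] {P : ObjectProperty (ShortComplex C)} {X : ShortComplex C}
    (hX : directedColimits P κ X) :
    ∃ (J : Type w) (_ : SmallCategory J) (_ : IsCardinalFiltered J κ) (D : J ⥤ ShortComplex C)
      (ι : D ⟶ (Functor.const J).obj X) (_ : ∀ j, P (D.obj j)),
      Nonempty (IsColimit (ShortComplex.π₁.mapCocone (Cocone.mk X ι))) ∧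
      Nonempty (IsColimit (ShortComplex.π₂.mapCocone (Cocone.mk X ι))) ∧
      Nonempty (IsColimit (ShortComplex.π₃.mapCocone (Cocone.mk X ι))) := by
  obtain ⟨J, _, _, ⟨p⟩⟩ := hX
  have := HasCardinalFilteredColimits.hasColimitsOfShape C κ J
  exact ⟨J, inferInstance, inferInstance, p.diag, p.ι, p.prop_diag_obj,
    ⟨isColimitOfPreserves _ p.isColimit⟩, ⟨isColimitOfPreserves _ p.isColimit⟩,
    ⟨isColimitOfPreserves _ p.isColimit⟩⟩

end

/-! ### The exact structure on `A` generated by an exact structure on `S`. -/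

section

lemma IsKernelCokernelPair.of_iso {C : Type*} [Category* C] [Preadditive C] {S T : ShortComplex C}
    (hS : IsKernelCokernelPair S) (e : S ≅ T) : IsKernelCokernelPair T := by
  have hf : T.f = e.inv.τ₁ ≫ S.f ≫ e.hom.τ₂ := by
    rw [e.inv.comm₁₂_assoc, ← ShortComplex.comp_τ₂, e.inv_hom_id, ShortComplex.id_τ₂,
      Category.comp_id]
  have hg : T.g = e.inv.τ₂ ≫ S.g ≫ e.hom.τ₃ := by
    rw [e.inv.comm₂₃_assoc, ← ShortComplex.comp_τ₃, e.inv_hom_id, ShortComplex.id_τ₃,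
      Category.comp_id]
  have := hS.mono
  have := hS.epi
  refine (isKernelCokernelPair_iff T).2 ⟨⟨by rw [hf]; infer_instance, fun W k hk ↦ ?_⟩,
    ⟨by rw [hg]; infer_instance, fun W k hk ↦ ?_⟩⟩
  · obtain ⟨l, hl⟩ := hS.exists_lift (k ≫ e.inv.τ₂) (by
      rw [Category.assoc, e.inv.comm₂₃, reassoc_of% hk, zero_comp])
    refine ⟨l ≫ e.hom.τ₁, ?_⟩
    rw [Category.assoc, e.hom.comm₁₂, reassoc_of% hl, ← ShortComplex.comp_τ₂, e.inv_hom_id,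
      ShortComplex.id_τ₂, Category.comp_id]
  · obtain ⟨l, hl⟩ := hS.exists_desc (e.hom.τ₂ ≫ k) (by
      rw [← e.hom.comm₁₂_assoc, hk, comp_zero])
    refine ⟨e.inv.τ₃ ≫ l, ?_⟩
    rw [← e.inv.comm₂₃_assoc, hl, ← ShortComplex.comp_τ₂_assoc, e.inv_hom_id,
      ShortComplex.id_τ₂, Category.id_comp]

variable {S : Type w} [SmallCategory S] [Preadditive S] {A : Type u} [Category.{w} A]
  [Preadditive A] {i : S ⥤ A} {κ : Cardinal.{w}} [Fact κ.IsRegular]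
  (hi : i.essImage.IsCardinalFilteredGenerator κ)

lemma QuillenExactStructure.locallyExact_mk_iff {E : QuillenExactStructure S} {X Y Z : A}
    {f : X ⟶ Y} {g : Y ⟶ Z} (h : f ≫ g = 0) :
    E.locallyExact i (ShortComplex.mk f g h) ↔
      (Mono f ∧ ∀ ⦃W : A⦄ (k : W ⟶ Y), k ≫ g = 0 → ∃ l, l ≫ f = k) ∧ E.IsLocalEpi i g :=
  and_congr_left' (nonempty_isLimit_kernelFork_iff _ _ _)

namespace CategoryTheory.ObjectProperty.IsCardinalFilteredGenerator

include hi

omit [Preadditive S] in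
/-- If the second and third terms of a `κ`-filtered diagram of kernels have a given colimit,
then so do the first terms. -/
lemma nonempty_isColimit_π₁ {J : Type w} [SmallCategory J] [IsCardinalFiltered J κ]
    [HasColimitsOfShape J A] {D : J ⥤ ShortComplex A} (c : Cocone D)
    (h₂ : IsColimit (ShortComplex.π₂.mapCocone c))
    (h₃ : IsColimit (ShortComplex.π₃.mapCocone c))
    (hD : ∀ j, Nonempty (IsLimit (KernelFork.ofι (D.obj j).f (D.obj j).zero)))
    (hc : Nonempty (IsLimit (KernelFork.ofι c.pt.f c.pt.zero))) :
    Nonempty (IsColimit (ShortComplex.π₁.mapCocone c)) := by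
  simp only [nonempty_isLimit_kernelFork_iff] at hD hc
  obtain ⟨_, hc⟩ := hc
  refine hi.nonempty_isColimit _ (fun s j x hx ↦ ?_) (fun s y ↦ ?_)
  · replace hx : x ≫ (c.ι.app j).τ₁ = 0 := hx
    let x' : i.obj s ⟶ (D.obj j).X₁ := x
    have := hi.isCardinalPresentable_obj s
    obtain ⟨j', φ, (hφ : (x' ≫ (D.obj j).f) ≫ (D.map φ).τ₂ = 0 ≫ (D.map φ).τ₂)⟩ :=
      IsCardinalPresentable.exists_eq_of_isColimit' κ h₂ (i := j) (x' ≫ (D.obj j).f) 0 (by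
        have : (x' ≫ (D.obj j).f) ≫ (c.ι.app j).τ₂ = 0 ≫ (c.ι.app j).τ₂ := by
          rw [Category.assoc, ← shortComplexCocone_comm₁₂, ← Category.assoc]
          exact (congrArg (· ≫ c.pt.f) hx).trans (zero_comp.trans zero_comp.symm)
        exact this)
    refine ⟨j', φ, ?_⟩
    have := (hD j').1
    have h : x' ≫ (D.map φ).τ₁ = 0 := by
      rw [← cancel_mono (D.obj j').f, Category.assoc, (D.map φ).comm₁₂, ← Category.assoc, hφ,
        zero_comp, zero_comp]
    exact h
  · let y' : i.obj s ⟶ c.pt.X₁ := y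
    have := hi.isCardinalPresentable_obj s
    -- Surjectivity: `y' ≫ c.pt.f` comes from the second term of some stage, is annihilated by `g`
    -- at a later stage, and lifts to the first term there.
    obtain ⟨j, (z : i.obj s ⟶ (D.obj j).X₂), (hz : z ≫ (c.ι.app j).τ₂ = y' ≫ c.pt.f)⟩ :=
      IsCardinalPresentable.exists_hom_of_isColimit κ h₂ (y' ≫ c.pt.f)
    obtain ⟨j', φ, (hφ : (z ≫ (D.obj j).g) ≫ (D.map φ).τ₃ = 0 ≫ (D.map φ).τ₃)⟩ :=
      IsCardinalPresentable.exists_eq_of_isColimit' κ h₃ (i := j) (z ≫ (D.obj j).g) 0 (by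
        have : (z ≫ (D.obj j).g) ≫ (c.ι.app j).τ₃ = 0 ≫ (c.ι.app j).τ₃ := by
          rw [Category.assoc, ← shortComplexCocone_comm₂₃, reassoc_of% hz, c.pt.zero, comp_zero,
            zero_comp]
        exact this)
    obtain ⟨l, hl⟩ := (hD j').2 (z ≫ (D.map φ).τ₂) (by
      rw [Category.assoc, (D.map φ).comm₂₃, ← Category.assoc, hφ, zero_comp])
    refine ⟨j', l, ?_⟩
    have h : l ≫ (c.ι.app j').τ₁ = y' := by
      rw [← cancel_mono c.pt.f, Category.assoc, shortComplexCocone_comm₁₂, reassoc_of% hl, ← hz]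
      have : (D.map φ).τ₂ ≫ (c.ι.app j').τ₂ = (c.ι.app j).τ₂ := by
        rw [← ShortComplex.comp_τ₂, c.w]
      exact congrArg (z ≫ ·) this
    exact h

variable [i.Full] [i.Faithful] [i.Additive]

/-- The inclusion of a `κ`-filtered generator preserves pushouts. -/
lemma isPushout_map [HasBinaryBiproducts S] {X Y X' P : S} {f : X ⟶ Y} {a : X ⟶ X'} {a' : Y ⟶ P}
    {f' : X' ⟶ P} (h : IsPushout f a a' f') :
    IsPushout (i.map f) (i.map a) (i.map a') (i.map f') := by
  have w : biprod.lift f (-a) ≫ biprod.desc a' f' = 0 := by simp [h.w]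
  obtain ⟨_, hd⟩ := (nonempty_isColimit_cokernelCofork_iff _ _ _).1
    (hi.nonempty_isColimit_cokernelCofork_map w ((nonempty_isColimit_cokernelCofork_iff _ _ _).2
      ⟨Preadditive.epi_of_cancel_zero _ fun k hk ↦ h.hom_ext
        (by simpa using congr(biprod.inl ≫ $hk)) (by simpa using congr(biprod.inr ≫ $hk)),
        fun W k hk ↦ ⟨h.desc (biprod.inl ≫ k) (biprod.inr ≫ k) (by
          rw [← sub_eq_zero, ← hk, biprod.lift_eq]
          simp [sub_eq_add_neg]), by ext <;> simp⟩⟩)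
      (by rw [← i.map_comp, w, i.map_zero]))
  refine isPushout_of_exists (by rw [← i.map_comp, h.w, i.map_comp]) (fun W u v huv ↦ ?_)
    (fun W l h₁ h₂ ↦ ?_)
  · obtain ⟨l, hl⟩ := hd (i.map biprod.fst ≫ u + i.map biprod.snd ≫ v) (by
      simp only [Preadditive.comp_add, ← i.map_comp_assoc, biprod.lift_fst, biprod.lift_snd]
      simp [huv])
    refine ⟨l, ?_, ?_⟩
    · rw [← biprod.inl_desc a' f', i.map_comp, Category.assoc, hl]
      simp [← i.map_comp_assoc]
    · rw [← biprod.inr_desc a' f', i.map_comp, Category.assoc, hl]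
      simp [← i.map_comp_assoc]
  · rw [← cancel_epi (i.map (biprod.desc a' f')), comp_zero, biprod.desc_eq, i.map_add,
      Preadditive.add_comp, i.map_comp, i.map_comp, Category.assoc, Category.assoc, h₁, h₂]
    simp

variable {E : QuillenExactStructure S}

omit [i.Additive] in
lemma locallyExact_map [i.Additive] {T : ShortComplex S} (hT : E.shortExact T) :
    E.locallyExact i (T.map i) :=
  ⟨(hi.isKernelCokernelPair_map (E.isKernelCokernelPair hT)).1,
    QuillenExactStructure.IsLocalEpi.map ⟨_, _, _, hT⟩⟩

variable [HasCardinalFilteredColimits A κ]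

omit [i.Full] [i.Faithful] [i.Additive] in
lemma locallyExact_of_directedColimits {X : ShortComplex A}
    (hX : directedColimits (E.locallyExact i) κ X) : E.locallyExact i X := by
  obtain ⟨J, _, _, D, ι, hD, ⟨h₁⟩, ⟨h₂⟩, ⟨h₃⟩⟩ := exists_of_directedColimits_shortComplex hX
  exact ⟨hi.nonempty_isLimit_of_isColimit (Cocone.mk X ι) h₁ h₂ h₃ fun j ↦ (hD j).1,
    hi.isLocalEpi_of_isColimit (Cocone.mk X ι) h₃ fun j ↦ (hD j).2⟩

variable [HasZeroObject S] [HasBinaryBiproducts S]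

/-- The right-hand side is a condition on one complex with no diagram chosen, so the axioms can be
checked on it. Any locally exact complex is isomorphic to the one built by `exists_kernel`, since
kernels are unique. -/
lemma directedColimits_iff_locallyExact (X : ShortComplex A) :
    directedColimits (E.shortExact.map i.mapShortComplex) κ X ↔ E.locallyExact i X := by
  refine ⟨fun hX ↦ hi.locallyExact_of_directedColimits (directedColimits_monotone ?_ _ hX),
    fun hX ↦ ?_⟩
  · rintro Y ⟨T, hT, ⟨e⟩⟩
    exact QuillenExactStructure.locallyExact_of_iso e (hi.locallyExact_map hT)
  · obtain ⟨K, f, h, ⟨hf⟩, hK⟩ := hX.2.exists_kernel hi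
    obtain ⟨hX⟩ := hX.1
    refine directedColimits_of_iso (X := ShortComplex.mk f X.g h)
      (ShortComplex.isoMk (IsLimit.conePointUniqueUpToIso hf hX)
        (Iso.refl _) (Iso.refl _) ?_ (by simp)) hK
    have := IsLimit.conePointUniqueUpToIso_hom_comp hf hX WalkingParallelPair.zero
    simpa using! this

/-- Only the cokernel part needs proof: presented as a colimit of sequences from `S`, the complex
inherits it, because both `i` and colimits preserve these cokernels. -/
lemma isKernelCokernelPair_of_locallyExact {X : ShortComplex A} (hX : E.locallyExact i X) :
    IsKernelCokernelPair X := by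
  refine ⟨hX.1, ?_⟩
  obtain ⟨J, _, _, D, ι, hD, ⟨h₁⟩, ⟨h₂⟩, ⟨h₃⟩⟩ :=
    exists_of_directedColimits_shortComplex ((hi.directedColimits_iff_locallyExact X).2 hX)
  refine nonempty_isColimit_cokernelCofork_of_isColimit (Cocone.mk X ι) h₂ h₃ fun j ↦ ?_
  obtain ⟨T, hT, ⟨e⟩⟩ := hD j
  exact ((hi.isKernelCokernelPair_map (E.isKernelCokernelPair hT)).of_iso e).2

/-- The morphism `a` is written as a colimit of morphisms of `S` over the same index category as a
presentation of `X`. Pushouts are then taken in `S` at each stage, and both `i` and colimits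
preserve them. -/
lemma exists_pushout_locallyExact {X : ShortComplex A} (hX : E.locallyExact i X) {X' : A}
    (a : X.X₁ ⟶ X') :
    ∃ (P : A) (a' : X.X₂ ⟶ P) (f' : X' ⟶ P) (g' : P ⟶ X.X₃) (w : f' ≫ g' = 0),
      IsPushout X.f a a' f' ∧ a' ≫ g' = X.g ∧ E.locallyExact i (ShortComplex.mk f' g' w) := by
  have hg := hX.2
  obtain ⟨_, hl⟩ := (nonempty_isLimit_kernelFork_iff _ _ _).1 hX.1
  have := QuillenExactStructure.ShortExactOver.isCardinalFiltered hi hg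
  have := QuillenExactStructure.ShortExactOver.final_fst hi hg
  have := QuillenExactStructure.ShortExactOver.final_snd hi hg
  have := hi.isCardinalFiltered_costructuredArrow X'
  have hx (c : E.ShortExactOver i X.g) :
      ∃ x : i.obj c.seq.X₁ ⟶ X.X₁, x ≫ X.f = i.map c.seq.f ≫ c.toY := by
    refine hl _ ?_
    rw [Category.assoc, c.w, ← i.map_comp_assoc, c.seq.zero, i.map_zero, zero_comp]
  choose x hx using hx
  have hx' {c d : E.ShortExactOver i X.g} (φ : c ⟶ d) : i.map φ.hom.τ₁ ≫ x d = x c := by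
    rw [← cancel_mono X.f, Category.assoc, hx, hx, ← i.map_comp_assoc, φ.hom.comm₁₂,
      i.map_comp_assoc, φ.w₂]
  -- An object of `Comma G (𝟭 _)` is a sequence over `X.g`, an object of `S` over `X'`, and a
  -- morphism to the latter from the first term of the former, compatible with `a`. Both projections
  -- are final.
  let G : E.ShortExactOver i X.g ⥤ CostructuredArrow i X' :=
    { obj c := CostructuredArrow.mk (x c ≫ a)
      map φ := CostructuredArrow.homMk φ.hom.τ₁ (by
        dsimp
        rw [← Category.assoc, hx' φ]) }
  have := isCardinalFiltered_comma_id G κ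
  have := isFiltered_of_isCardinalFiltered (E.ShortExactOver i X.g) κ
  have := isFiltered_of_isCardinalFiltered (CostructuredArrow i X') κ
  have := HasCardinalFilteredColimits.hasColimitsOfShape A κ (E.ShortExactOver i X.g)
  have := HasCardinalFilteredColimits.hasColimitsOfShape A κ (Comma G (𝟭 _))
  let c := QuillenExactStructure.ShortExactOver.cocone E i X.f X.zero x hx hx'
  have h₂ : IsColimit (ShortComplex.π₂.mapCocone c) :=
    (Functor.Final.isColimitWhiskerEquiv
      (QuillenExactStructure.ShortExactOver.toComma E i X.g ⋙ Comma.fst _ _) _).symm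
      (hi.nonempty_isColimit_canonicalCocone X.X₂).some
  have h₃ : IsColimit (ShortComplex.π₃.mapCocone c) :=
    (Functor.Final.isColimitWhiskerEquiv
      (QuillenExactStructure.ShortExactOver.toComma E i X.g ⋙ Comma.snd _ _) _).symm
      (hi.nonempty_isColimit_canonicalCocone X.X₃).some
  obtain ⟨h₁⟩ := hi.nonempty_isColimit_π₁ c h₂ h₃
    (fun d ↦ (hi.isKernelCokernelPair_map (E.isKernelCokernelPair d.shortExact)).1) hX.1
  obtain ⟨P, a', f', g', w, sq, hg', hQ⟩ := exists_pushout_of_isColimit κ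
    (c := c.whisker (Comma.fst G (𝟭 _)))
    ((Functor.Final.isColimitWhiskerEquiv (Comma.fst G (𝟭 _)) _).symm h₁)
    ((Functor.Final.isColimitWhiskerEquiv (Comma.fst G (𝟭 _)) _).symm h₂)
    ((Functor.Final.isColimitWhiskerEquiv (Comma.fst G (𝟭 _)) _).symm h₃)
    ((Functor.Final.isColimitWhiskerEquiv (Comma.snd G (𝟭 _)) _).symm
      (hi.nonempty_isColimit_canonicalCocone X').some)
    (fun m ↦ i.map m.hom.left)
    (fun {m n} φ ↦ by
      have h : φ.left.hom.τ₁ ≫ n.hom.left = m.hom.left ≫ φ.right.left :=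
        congr_arg CommaMorphism.left φ.w
      exact (i.map_comp _ _).symm.trans ((congrArg i.map h.symm).trans (i.map_comp _ _)))
    a (fun m ↦ (CostructuredArrow.w m.hom).symm)
    (E.shortExact.map i.mapShortComplex)
    (fun m ↦ by
      obtain ⟨P, a', f', g', w, sq, hg', hP⟩ :=
        E.exists_pushout_shortExact m.left.shortExact m.hom.left
      exact ⟨i.obj P, i.map a', i.map f', i.map g',
        (i.map_comp _ _).symm.trans ((congrArg i.map w).trans (i.map_zero _ _)),
        hi.isPushout_map sq, (i.map_comp _ _).symm.trans (congrArg i.map hg'),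
        ObjectProperty.prop_map_obj _ _ hP⟩)
  exact ⟨P, a', f', g', w, sq, hg', (hi.directedColimits_iff_locallyExact _).1 hQ⟩

open ZeroObject in
/-- The exact structure on a category with a `κ`-filtered generator `S` given by
the `κ`-filtered colimits of short exact sequences in `S`. -/
def exactStructure [HasZeroObject A] [HasBinaryBiproducts A] (E : QuillenExactStructure S) :
    QuillenExactStructure A where
  shortExact := E.locallyExact i
  of_iso e h := QuillenExactStructure.locallyExact_of_iso e h
  isKernelCokernelPair h := hi.isKernelCokernelPair_of_locallyExact h
  admissibleMono_id X := by
    have : IsSplitEpi (0 : X ⟶ (0 : A)) := ⟨⟨⟨0, by simp⟩⟩⟩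
    exact ⟨0, 0, by simp, (QuillenExactStructure.locallyExact_mk_iff _).2
      ⟨⟨inferInstance, fun W k _ ↦ ⟨k, Category.comp_id k⟩⟩, .of_isSplitEpi _⟩⟩
  admissibleEpi_id X :=
    ⟨0, 0, by simp, (QuillenExactStructure.locallyExact_mk_iff _).2
      ⟨⟨⟨fun _ _ _ ↦ (isZero_zero A).eq_of_tgt _ _⟩, fun W k hk ↦ ⟨0, by
        simpa using hk.symm⟩⟩, .of_isSplitEpi _⟩⟩
  admissibleMono_comp {X Y Z} f g := by
    rintro ⟨C, p, hfp, hf⟩ ⟨D, q, hgq, hg⟩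
    -- The cokernel of `f ≫ g` is the pushout of `g` along the cokernel `p` of `f`.
    obtain ⟨P, (a' : Z ⟶ P), c, (d : P ⟶ D), hcd, ⟨⟨(sq : g ≫ a' = p ≫ c)⟩, _⟩,
      (hd : a' ≫ d = q), hP⟩ := hi.exists_pushout_locallyExact hg p
    obtain ⟨⟨_, hf'⟩, hp⟩ := (QuillenExactStructure.locallyExact_mk_iff _).1 hf
    obtain ⟨⟨_, hg'⟩, hq⟩ := (QuillenExactStructure.locallyExact_mk_iff _).1 hg
    obtain ⟨⟨_, hc'⟩, -⟩ := (QuillenExactStructure.locallyExact_mk_iff _).1 hP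
    refine ⟨P, a', by rw [Category.assoc, sq, reassoc_of% hfp, zero_comp],
      (QuillenExactStructure.locallyExact_mk_iff _).2 ⟨⟨mono_comp f g, fun W k hk ↦ ?_⟩,
        fun T t ↦ ?_⟩⟩
    · obtain ⟨l, hl⟩ := hg' k (by rw [← hd, reassoc_of% hk, zero_comp])
      obtain ⟨m, hm⟩ := hf' l (by
        rw [← cancel_mono c, Category.assoc, ← sq, reassoc_of% hl, hk, zero_comp])
      exact ⟨m, by rw [reassoc_of% hm, hl]⟩
    -- Two successive covers: the first lifts the image of `t` in `D` to `Z`; the error then comes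
    -- from `C` and is lifted along `p` after the second.
    · obtain ⟨T₁, p₁, u, hp₁, hu⟩ := hq (t ≫ d)
      obtain ⟨y, hy⟩ := hc' (i.map p₁ ≫ t - u ≫ a') (by
        rw [Preadditive.sub_comp, Category.assoc, Category.assoc, hd, hu, sub_self])
      obtain ⟨T₂, p₂, v, hp₂, hv⟩ := hp y
      refine ⟨T₂, p₂ ≫ p₁, i.map p₂ ≫ u + v ≫ g, E.admissibleEpi_comp _ _ hp₂ hp₁, ?_⟩
      rw [Preadditive.add_comp, Category.assoc, Category.assoc, sq, reassoc_of% hv, hy,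
        Preadditive.comp_sub, i.map_comp, Category.assoc]
      abel
  admissibleEpi_comp f g := by
    rintro ⟨_, _, _, hf⟩ ⟨_, _, _, hg⟩
    have h := QuillenExactStructure.IsLocalEpi.comp hf.2 hg.2
    obtain ⟨K, k, hk, hK, -⟩ := h.exists_kernel hi
    exact ⟨K, k, hk, hK, h⟩
  exists_pushout f a := by
    rintro ⟨_, _, _, hf⟩
    obtain ⟨P, a', f', g', w, sq, -, hP⟩ := hi.exists_pushout_locallyExact hf a
    exact ⟨P, a', f', sq, _, g', w, hP⟩
  exists_pullback {Y Z Z'} g c := by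
    rintro ⟨_, _, _, hg⟩
    replace hg : E.IsLocalEpi i g := hg.2
    -- The pullback is the kernel of `(g, -c)`. It exists because this is a local epimorphism, `g`
    -- being its restriction to the first summand.
    have hgc : E.IsLocalEpi i (biprod.desc g (-c)) := by
      refine QuillenExactStructure.IsLocalEpi.of_comp (f := biprod.inl) ?_
      rwa [biprod.inl_desc]
    obtain ⟨K, k, hk, hK, -⟩ := hgc.exists_kernel hi
    obtain ⟨_, hl⟩ := (nonempty_isLimit_kernelFork_iff _ _ _).1 hK
    have hk' : k ≫ biprod.snd ≫ c = k ≫ biprod.fst ≫ g := by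
      rw [biprod.desc_eq, Preadditive.comp_add] at hk
      rw [← sub_eq_zero, ← neg_eq_zero]
      simpa [← sub_eq_add_neg] using hk
    have h : E.IsLocalEpi i (k ≫ biprod.snd) := fun T t ↦ by
      obtain ⟨T', p, u, hp, hu⟩ := hg (t ≫ c)
      obtain ⟨l, hl⟩ := hl (biprod.lift u (i.map p ≫ t)) (by simp [hu])
      exact ⟨T', p, l, hp, by rw [← Category.assoc, hl, biprod.lift_snd]⟩
    obtain ⟨K', k', hk', hK', -⟩ := h.exists_kernel hi
    refine ⟨K, k ≫ biprod.snd, k ≫ biprod.fst, isPullback_of_exists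
      (by rwa [Category.assoc, Category.assoc]) (fun W u v huv ↦ ?_) (fun W l h₁ h₂ ↦ ?_),
      K', k', hk', hK', h⟩
    · obtain ⟨l, hl⟩ := hl (biprod.lift v u) (by simp [huv])
      exact ⟨l, by rw [← Category.assoc, hl, biprod.lift_snd],
        by rw [← Category.assoc, hl, biprod.lift_fst]⟩
    · rw [← cancel_mono k]
      ext <;> simp [h₁, h₂]

end CategoryTheory.ObjectProperty.IsCardinalFilteredGenerator

end

/-! ### Extension-closedness, restriction to `S`, and uniqueness. -/

section

lemma isCardinalPresentable_of_isPushout {C : Type u} [Category.{v} C] [LocallySmall.{w} C]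
    (κ : Cardinal.{w}) [Fact κ.IsRegular] {X Y X' P : C} {f : X ⟶ Y} {a : X ⟶ X'} {a' : Y ⟶ P}
    {f' : X' ⟶ P} (h : IsPushout f a a' f') (hX : IsCardinalPresentable X κ)
    (hY : IsCardinalPresentable Y κ) (hX' : IsCardinalPresentable X' κ) :
    IsCardinalPresentable P κ := by
  have (k : WalkingSpan) : IsCardinalPresentable ((span f a).obj k) κ := by
    rcases k with _ | _ | _
    · exact hX
    · exact hY
    · exact hX'
  exact isCardinalPresentable_of_isColimit _ h.isColimit κ
    (hasCardinalLT_of_finite _ κ (Cardinal.IsRegular.aleph0_le Fact.out))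

variable {A : Type u} [Category.{w} A] [Preadditive A] {κ : Cardinal.{w}} [Fact κ.IsRegular]

/-- In a locally `κ`-coherent exact structure, the `κ`-presentable objects are closed under
extensions. -/
lemma QuillenExactStructure.IsLocallyCoherent.isExtensionClosed
    [HasZeroObject A] [HasBinaryBiproducts A] [HasCardinalFilteredColimits A κ]
    {F : QuillenExactStructure A} (hF : F.IsLocallyCoherent κ) :
    F.IsExtensionClosed (isCardinalPresentable A κ) := by
  intro T hT h₁ h₃
  obtain ⟨J, _, _, D, ι, hD, -, -, ⟨c₃⟩⟩ :=
    exists_of_directedColimits_shortComplex ((hF T).1 hT)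
  rw [isCardinalPresentable_iff] at h₁ h₃ ⊢
  -- The third term is a retract of that of some stage. After pushing this stage out to have first
  -- term `T.X₁`, its middle term `P` is still presentable, and the section `s` makes `T.X₂` a
  -- retract of `P`.
  obtain ⟨j, (s : T.X₃ ⟶ (D.obj j).X₃), (hs : s ≫ (ι.app j).τ₃ = 𝟙 _)⟩ :=
    IsCardinalPresentable.exists_hom_of_isColimit κ c₃ (𝟙 T.X₃)
  let φ : D.obj j ⟶ T := ι.app j
  obtain ⟨hj, hj₁, hj₂, hj₃⟩ := hD j
  obtain ⟨P, a', f', g', w, sq, hg', hP⟩ := F.exists_pushout_shortExact hj φ.τ₁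
  have hφ₂ : (D.obj j).f ≫ φ.τ₂ = φ.τ₁ ≫ T.f := φ.comm₁₂.symm
  let ψ : ShortComplex.mk f' g' w ⟶ T :=
    { τ₁ := 𝟙 _
      τ₂ := sq.desc φ.τ₂ T.f hφ₂
      τ₃ := φ.τ₃
      comm₁₂ := by
        dsimp
        rw [Category.id_comp, sq.inr_desc]
      comm₂₃ := by
        dsimp
        apply sq.hom_ext
        · rw [sq.inl_desc_assoc, φ.comm₂₃, reassoc_of% hg']
        · rw [sq.inr_desc_assoc, T.zero, reassoc_of% w, zero_comp] }
  have : IsIso ψ.τ₁ := inferInstanceAs (IsIso (𝟙 _))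
  obtain ⟨σ, hσ⟩ := F.exists_section_of_shortExact hP hT ψ s hs
  have hP' : IsCardinalPresentable P κ := isCardinalPresentable_of_isPushout κ sq hj₁ hj₂ h₁
  exact Retract.isCardinalPresentable (X := P) { i := σ, r := ψ.τ₂, retract := hσ } κ

variable {S : Type w} [SmallCategory S] [Preadditive S] {i : S ⥤ A}
  [i.Full] [i.Faithful] [i.Additive] [HasZeroObject S] [HasBinaryBiproducts S]
  (hi : i.essImage.IsCardinalFilteredGenerator κ)
  [HasCardinalFilteredColimits A κ] {E : QuillenExactStructure S}

namespace CategoryTheory.ObjectProperty.IsCardinalFilteredGenerator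

include hi

/-- Testing local epimorphy on the identity of the third term gives `u` such that `u ≫ T.g` is an
admissible epimorphism of `S`; the obscure axiom then applies to `T.g`. -/
lemma locallyExact_map_iff (T : ShortComplex S) :
    E.locallyExact i (T.map i) ↔ E.shortExact T := by
  refine ⟨fun hT ↦ ?_, hi.locallyExact_map⟩
  obtain ⟨T', p, (u : i.obj T' ⟶ i.obj T.X₂), hp,
    (hu : u ≫ i.map T.g = i.map p ≫ 𝟙 (i.obj T.X₃))⟩ := hT.2 (𝟙 (i.obj T.X₃))
  refine E.shortExact_of_admissibleEpi_comp
    (isKernelCokernelPair_of_map i (hi.isKernelCokernelPair_of_locallyExact hT)).1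
    (i.preimage u) ?_
  have : i.preimage u ≫ T.g = p := i.map_injective (by
    rw [i.map_comp, i.map_preimage]
    exact hu.trans (Category.comp_id (i.map p)))
  rwa [this]

variable [HasZeroObject A] [HasBinaryBiproducts A]

/-- A cover of the third term lifts to the middle term, so its kernel maps to the first. The pushout
along this map is an extension formed in `S`, isomorphic to `T` by the short five lemma. -/
lemma isExtensionClosed_exactStructure (E : QuillenExactStructure S) :
    (hi.exactStructure E).IsExtensionClosed i.essImage := by
  rintro T hT ⟨X, ⟨e₁⟩⟩ ⟨Z, ⟨e₃⟩⟩
  obtain ⟨⟨hT₁⟩, hT₂⟩ := hT.imp_left (nonempty_isLimit_kernelFork_iff _ _ _).1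
  obtain ⟨Z', p, u, ⟨K, k, hkp, hK⟩, hu⟩ := hT₂ e₃.hom

  obtain ⟨x, hx⟩ := (IsKernelCokernelPair.exists_lift
    ((hi.exactStructure E).isKernelCokernelPair hT)) (i.map k ≫ u) (by
      rw [Category.assoc, hu, ← i.map_comp_assoc, hkp, i.map_zero, zero_comp])
  let x' : K ⟶ X := i.preimage (x ≫ e₁.inv)
  have hx' : i.map x' ≫ e₁.hom = x := by simp [x']
  obtain ⟨P, a', f', g', w, sq, hg', hP⟩ := E.exists_pushout_shortExact hK x'
  dsimp at sq hg'
  have sq' := hi.isPushout_map sq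
  have w' : i.map f' ≫ i.map g' = 0 := by rw [← i.map_comp, w, i.map_zero]
  have hP' : E.locallyExact i (ShortComplex.mk _ _ w') := hi.locallyExact_map hP
  have hd : i.map k ≫ u = i.map x' ≫ e₁.hom ≫ T.f := by
    rw [← hx, reassoc_of% hx']
  let ψ : ShortComplex.mk _ _ w' ⟶ T :=
    { τ₁ := e₁.hom
      τ₂ := sq'.desc u (e₁.hom ≫ T.f) hd
      τ₃ := e₃.hom
      comm₁₂ := (sq'.inr_desc _ _ hd).symm
      comm₂₃ := by
        dsimp
        apply sq'.hom_ext
        · rw [sq'.inl_desc_assoc, hu, ← i.map_comp_assoc, hg']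
        · rw [sq'.inr_desc_assoc, Category.assoc, T.zero, reassoc_of% w', zero_comp, comp_zero] }
  have : IsIso ψ.τ₁ := inferInstanceAs (IsIso e₁.hom)
  have : IsIso ψ.τ₃ := inferInstanceAs (IsIso e₃.hom)
  have := (hi.exactStructure E).isIso_of_shortExact hP' hT ψ
  exact ⟨P, ⟨asIso ψ.τ₂⟩⟩

lemma isLocallyCoherent_exactStructure (E : QuillenExactStructure S) :
    (hi.exactStructure E).IsLocallyCoherent κ := by
  intro T
  change E.locallyExact i T ↔ _
  refine ⟨fun hT ↦ directedColimits_monotone ?_ _ ((hi.directedColimits_iff_locallyExact T).2 hT),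
    fun hT ↦ hi.locallyExact_of_directedColimits (directedColimits_monotone ?_ _ hT)⟩
  · rintro Y ⟨U, hU, ⟨e⟩⟩
    have (X : S) : isCardinalPresentable A κ (i.obj X) := hi.isCardinalPresentable_obj X
    exact ⟨QuillenExactStructure.locallyExact_of_iso e (hi.locallyExact_map hU),
      (isCardinalPresentable A κ).prop_of_iso (ShortComplex.π₁.mapIso e) (this U.X₁),
      (isCardinalPresentable A κ).prop_of_iso (ShortComplex.π₂.mapIso e) (this U.X₂),
      (isCardinalPresentable A κ).prop_of_iso (ShortComplex.π₃.mapIso e) (this U.X₃)⟩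
  · exact fun Y hY ↦ hY.1

/-- A locally `κ`-coherent exact structure is determined by its restriction to an
extension-closed generator. -/
lemma eq_exactStructure {F : QuillenExactStructure A} (hF : F.IsLocallyCoherent κ)
    (hF' : F.IsExtensionClosed i.essImage)
    (hE : ∀ T : ShortComplex S, E.shortExact T ↔ F.shortExact (T.map i)) :
    F = hi.exactStructure E := by
  refine QuillenExactStructure.ext (funext fun T ↦ propext ?_)
  change _ ↔ E.locallyExact i T
  refine ⟨fun hT ↦ hi.locallyExact_of_directedColimits
      (directedColimits_monotone ?_ _ ((hF T).1 hT)),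
    fun hT ↦ (hF T).2
      (directedColimits_monotone ?_ _ ((hi.directedColimits_iff_locallyExact T).2 hT))⟩
  · rintro T ⟨hT, h₁, -, -⟩
    refine ⟨(F.isKernelCokernelPair hT).1, fun Z t ↦ ?_⟩
    -- The pullback extends `i.obj Z` by `T.X₁`, which is only a retract of some `i.obj X₁`. Pushing
    -- out along the inclusion gives an extension of objects of `S`, hence an object `W` of `S`
    -- covering `Z`; the retraction supplies the map from it to `T.X₂`.
    obtain ⟨Y', c', f', g', w', sq, hc', hY'⟩ := F.exists_pullback_shortExact hT t
    rw [hi.isPresentable_eq_retractClosure] at h₁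
    obtain ⟨X₀, ⟨X₁, ⟨e⟩⟩, ⟨r⟩⟩ := h₁
    obtain ⟨Y'', a'', f'', g'', w'', sq', hg'', hY''⟩ :=
      F.exists_pushout_shortExact hY' (r.i ≫ e.inv)
    dsimp at sq' hg''
    obtain ⟨W, ⟨eW⟩⟩ := hF' _ hY'' (i.obj_mem_essImage _) (i.obj_mem_essImage _)
    dsimp at eW
    have hd : f' ≫ c' = (r.i ≫ e.inv) ≫ e.hom ≫ r.r ≫ T.f := by simp [hc']
    refine ⟨W, i.preimage (eW.hom ≫ g''), eW.hom ≫ sq'.desc c' (e.hom ≫ r.r ≫ T.f) hd,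
      ⟨X₁, i.preimage (f'' ≫ eW.inv), i.map_injective (by simp [w'']), (hE _).2 ?_⟩, ?_⟩
    · have w₁ : i.map (i.preimage (f'' ≫ eW.inv)) ≫ i.map (i.preimage (eW.hom ≫ g'')) = 0 := by
        simp [w'']
      exact F.of_iso_mk hY'' w₁ (Iso.refl _) eW.symm (Iso.refl _) (by simp) (by simp)
    · rw [i.map_preimage, Category.assoc, Category.assoc]
      congr 1
      apply sq'.hom_ext
      · rw [sq'.inl_desc_assoc, ← sq.w, reassoc_of% hg'']
      · rw [sq'.inr_desc_assoc, Category.assoc, Category.assoc, T.zero, reassoc_of% w'', comp_zero,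
          comp_zero, zero_comp]
  · rintro Y ⟨U, hU, ⟨e⟩⟩
    have (X : S) : isCardinalPresentable A κ (i.obj X) := hi.isCardinalPresentable_obj X
    exact ⟨F.of_iso e ((hE U).1 hU),
      (isCardinalPresentable A κ).prop_of_iso (ShortComplex.π₁.mapIso e) (this U.X₁),
      (isCardinalPresentable A κ).prop_of_iso (ShortComplex.π₂.mapIso e) (this U.X₂),
      (isCardinalPresentable A κ).prop_of_iso (ShortComplex.π₃.mapIso e) (this U.X₃)⟩

end CategoryTheory.ObjectProperty.IsCardinalFilteredGenerator

end

/-! ### The bijection for a `κ`-accessible category. -/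

section

variable (A : Type u) [Category.{w} A] [Preadditive A] [HasFiniteBiproducts A]
  (κ : Cardinal.{w}) [Fact κ.IsRegular]

instance hasFiniteBiproducts_presentables : HasFiniteBiproducts (Presentables A κ) := by
  have (n : ℕ) : (isCardinalPresentable A κ).IsClosedUnderColimitsOfShape (Discrete (Fin n)) :=
    isClosedUnderColimitsOfShape_isCardinalPresentable A (κ := κ)
      (hasCardinalLT_of_finite _ κ (Cardinal.IsRegular.aleph0_le Fact.out))
  have : HasFiniteCoproducts (Presentables A κ) := ⟨fun n ↦ inferInstance⟩
  exact HasFiniteBiproducts.of_hasFiniteCoproducts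

omit [Preadditive A] [HasFiniteBiproducts A] in
lemma essImage_presentables_incl :
    (Presentables.incl A κ).essImage = isCardinalPresentable A κ := by
  ext X
  exact ⟨fun ⟨Y, ⟨e⟩⟩ ↦ (isCardinalPresentable A κ).prop_of_iso e Y.2,
    fun hX ↦ ⟨⟨X, hX⟩, ⟨Iso.refl _⟩⟩⟩

variable [IsCardinalAccessibleCategory A κ]

theorem exists_equiv_isLocallyCoherent :
    ∃ e : QuillenExactStructure (Presentables A κ) ≃
          {F : QuillenExactStructure A // F.IsLocallyCoherent κ},
        (∀ (E : QuillenExactStructure (Presentables A κ)) (T : ShortComplex A),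
          (e E).1.shortExact T ↔
            directedColimits (E.shortExact.map (Presentables.incl A κ).mapShortComplex) κ T) ∧
        (∀ (F : {F : QuillenExactStructure A // F.IsLocallyCoherent κ})
            (T : ShortComplex (Presentables A κ)),
          (e.symm F).shortExact T ↔ F.1.shortExact (T.map (Presentables.incl A κ))) := by
  have := hasBinaryBiproducts_of_finite_biproducts A
  -- The presentable objects form only an essentially small category, whereas the index categories
  -- above need `S` to be small; the exact structure is carried over to a small model.
  let S := SmallModel.{w} (Presentables A κ)
  let ψ : S ⥤ Presentables A κ := (equivSmallModel (Presentables A κ)).inverse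
  let _ : Preadditive S := Preadditive.ofFullyFaithful (.ofFullyFaithful ψ)
  have : ψ.Additive := (Functor.FullyFaithful.ofFullyFaithful ψ).additive_ofFullyFaithful
  have : HasFiniteCoproducts S :=
    ⟨fun n ↦ Adjunction.hasColimitsOfShape_of_equivalence ψ⟩
  have : HasFiniteBiproducts S := HasFiniteBiproducts.of_hasFiniteCoproducts
  have := hasBinaryBiproducts_of_finite_biproducts S
  let i : S ⥤ A := ψ ⋙ Presentables.incl A κ
  have hψ (T : ShortComplex (Presentables A κ)) : ∃ T' : ShortComplex S, Nonempty (T'.map ψ ≅ T) :=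
    ⟨T.map ψ.inv, ⟨T.mapNatIso ψ.asEquivalence.counitIso⟩⟩
  have hi' : i.essImage = isCardinalPresentable A κ := by
    ext X
    refine ⟨fun ⟨Y, ⟨e⟩⟩ ↦ (isCardinalPresentable A κ).prop_of_iso e (ψ.obj Y).2, fun hX ↦ ?_⟩
    exact ⟨ψ.objPreimage ⟨X, hX⟩, ⟨(Presentables.incl A κ).mapIso (ψ.objObjPreimageIso ⟨X, hX⟩)⟩⟩
  have hi : i.essImage.IsCardinalFilteredGenerator κ := by
    rw [hi']
    exact isCardinalFilteredGenerator_isCardinalPresentable A κ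
  let R (E : QuillenExactStructure (Presentables A κ)) : QuillenExactStructure S :=
    E.inherit ψ (fun T _ _ _ ↦ Functor.EssSurj.mem_essImage _ _)
  have hc (F : QuillenExactStructure A) (hF : F.IsLocallyCoherent κ) :
      F.IsExtensionClosed (Presentables.incl A κ).essImage := by
    rw [essImage_presentables_incl]
    exact hF.isExtensionClosed
  have hc' (F : QuillenExactStructure A) (hF : F.IsLocallyCoherent κ) :
      F.IsExtensionClosed i.essImage := by
    rw [hi']
    exact hF.isExtensionClosed
  refine ⟨
    { toFun E := ⟨hi.exactStructure (R E), hi.isLocallyCoherent_exactStructure _⟩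
      invFun F := F.1.inherit (Presentables.incl A κ) (hc F.1 F.2)
      left_inv E := ?_
      right_inv F := ?_ }, fun E T ↦ ?_, fun F T ↦ Iff.rfl⟩
  · refine QuillenExactStructure.ext (funext fun T ↦ propext ?_)
    obtain ⟨T', ⟨e⟩⟩ := hψ T
    have h₁ : (R E).shortExact T' ↔ E.shortExact T := ⟨E.of_iso e, E.of_iso e.symm⟩
    have h₂ : (R E).locallyExact i (T'.map i) ↔
        (R E).locallyExact i (T.map (Presentables.incl A κ)) :=
      ⟨QuillenExactStructure.locallyExact_of_iso ((Presentables.incl A κ).mapShortComplex.mapIso e),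
        QuillenExactStructure.locallyExact_of_iso
          ((Presentables.incl A κ).mapShortComplex.mapIso e.symm)⟩
    exact h₂.symm.trans ((hi.locallyExact_map_iff T').trans h₁)
  · exact Subtype.ext (hi.eq_exactStructure F.2 (hc' F.1 F.2) (fun T ↦ Iff.rfl)).symm
  · refine (hi.directedColimits_iff_locallyExact T).symm.trans
      ⟨directedColimits_monotone ?_ T, directedColimits_monotone ?_ T⟩
    · rintro X ⟨U, hU, ⟨e⟩⟩
      exact ⟨U.map ψ, hU, ⟨e⟩⟩
    · rintro X ⟨U, hU, ⟨e⟩⟩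
      obtain ⟨U', ⟨e'⟩⟩ := hψ U
      exact ⟨U', E.of_iso e'.symm hU, ⟨(Presentables.incl A κ).mapShortComplex.mapIso e' ≪≫ e⟩⟩

end

/-! ### Ind-objects as additive presheaves with `κ`-filtered categories of elements. -/

section

/-- The hypotheses `h₁` and `h₂` let a diagram of size less than `κ` over `c.pt` descend to a single
stage, where a cocone exists by `h₃`. -/
lemma isCardinalFiltered_costructuredArrow_of_cocone {S : Type w} [SmallCategory S] {C : Type u}
    [Category.{v} C] (i : S ⥤ C) (κ : Cardinal.{w}) [Fact κ.IsRegular] {J : Type w}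
    [SmallCategory J] [IsCardinalFiltered J κ] {D : J ⥤ C} (c : Cocone D)
    (h₁ : ∀ (s : S) (x : i.obj s ⟶ c.pt), ∃ (j : J) (z : i.obj s ⟶ D.obj j), z ≫ c.ι.app j = x)
    (h₂ : ∀ (s : S) (j : J) (x y : i.obj s ⟶ D.obj j), x ≫ c.ι.app j = y ≫ c.ι.app j →
      ∃ (j' : J) (φ : j ⟶ j'), x ≫ D.map φ = y ≫ D.map φ)
    (h₃ : ∀ j, IsCardinalFiltered (CostructuredArrow i (D.obj j)) κ) :
    IsCardinalFiltered (CostructuredArrow i c.pt) κ where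
  nonempty_cocone {B _} K hB := by
    have hB' : HasCardinalLT B κ := hasCardinalLT_of_hasCardinalLT_arrow hB
    choose j z hz using fun b ↦ h₁ _ (K.obj b).hom
    let m := IsCardinalFiltered.max j hB'
    let z' (b : B) : i.obj (K.obj b).left ⟶ D.obj m :=
      z b ≫ D.map (IsCardinalFiltered.toMax j hB' b)
    have hz' (b : B) : z' b ≫ c.ι.app m = (K.obj b).hom := by
      rw [Category.assoc, c.w, hz]
    have hu (φ : Arrow B) : ∃ (k : J) (u : m ⟶ k),
        (i.map (K.map φ.hom).left ≫ z' φ.right) ≫ D.map u = z' φ.left ≫ D.map u := by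
      refine h₂ _ _ _ _ ?_
      rw [Category.assoc, hz', hz']
      exact CostructuredArrow.w (K.map φ.hom)
    choose k u hu using hu
    -- Each arrow of the diagram commutes only after its own further step `u`; with fewer than `κ`
    -- arrows, these steps merge into one.
    obtain ⟨n, a, v, hav⟩ := IsCardinalFiltered.wideSpan u hB
    have hv {b b' : B} (φ : b ⟶ b') :
        i.map (K.map φ).left ≫ z' b' ≫ D.map v = z' b ≫ D.map v := by
      have h : (i.map (K.map φ).left ≫ z' b') ≫ D.map (u (Arrow.mk φ)) =
        z' b ≫ D.map (u (Arrow.mk φ)) := hu (Arrow.mk φ)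
      rw [← hav (Arrow.mk φ), D.map_comp, ← Category.assoc, ← Category.assoc, h, Category.assoc]
    let K' : B ⥤ CostructuredArrow i (D.obj n) :=
      { obj b := CostructuredArrow.mk (z' b ≫ D.map v)
        map φ := CostructuredArrow.homMk (K.map φ).left (hv φ) }
    let cc := IsCardinalFiltered.cocone K' hB
    have hcc (b : B) : i.map (cc.ι.app b).left ≫ cc.pt.hom = z' b ≫ D.map v :=
      CostructuredArrow.w (cc.ι.app b)
    exact ⟨
      { pt := CostructuredArrow.mk (cc.pt.hom ≫ c.ι.app n)
        ι :=
          { app b := CostructuredArrow.homMk (cc.ι.app b).left (by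
              dsimp
              rw [reassoc_of% (hcc b), c.w, hz'])
            naturality b b' φ := by
              have := congr_arg CommaMorphism.left (cc.ι.naturality φ)
              ext
              exact this } }⟩

end

section

open Opposite

variable {S : Type w} [SmallCategory S] [Preadditive S]

/-- The Yoneda lemma for additive presheaves of abelian groups. -/
def preadditiveYonedaEquiv (s : S) (X : Sᵒᵖ ⥤ AddCommGrpCat.{w}) [X.Additive] :
    (preadditiveYoneda.obj s ⟶ X) ≃ X.obj (op s) where
  toFun f := (f.app (op s)).hom (𝟙 s)
  invFun x :=
    { app t := AddCommGrpCat.ofHom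
        { toFun := fun (f : t.unop ⟶ s) ↦ (X.map f.op).hom x
          map_zero' := by
            change (X.map 0).hom x = 0
            rw [X.map_zero]
            rfl
          map_add' := fun (f g : t.unop ⟶ s) ↦ by
            change (X.map (f.op + g.op)).hom x = _
            rw [X.map_add]
            rfl }
      naturality t t' φ := by
        ext (f : t.unop ⟶ s)
        change (X.map (f.op ≫ φ)).hom x = (X.map φ).hom ((X.map f.op).hom x)
        rw [X.map_comp]
        rfl }
  left_inv f := by
    ext t (g : t.unop ⟶ s)
    have h := congr(AddCommGrpCat.Hom.hom $(f.naturality g.op) (𝟙 s))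
    refine h.symm.trans ?_
    change (f.app t).hom (g ≫ 𝟙 s) = (f.app t).hom g
    rw [Category.comp_id]
  right_inv x := by
    change (X.map (𝟙 (op s))).hom x = x
    rw [X.map_id]
    rfl

lemma preadditiveYonedaEquiv_comp {s : S} {X Y : Sᵒᵖ ⥤ AddCommGrpCat.{w}} [X.Additive]
    [Y.Additive] (f : preadditiveYoneda.obj s ⟶ X) (g : X ⟶ Y) :
    preadditiveYonedaEquiv s Y (f ≫ g) = (g.app (op s)).hom (preadditiveYonedaEquiv s X f) :=
  rfl

lemma additive_of_isColimit {J : Type*} [Category* J] [HasColimitsOfShape J AddCommGrpCat.{w}]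
    {D : J ⥤ Sᵒᵖ ⥤ AddCommGrpCat.{w}} {c : Cocone D} (hc : IsColimit c)
    (hD : ∀ j, (D.obj j).Additive) : c.pt.Additive where
  map_add {s t f g} := by
    refine (isColimitOfPreserves ((evaluation _ _).obj s) hc).hom_ext fun j ↦ ?_
    have hn (h : s ⟶ t) : (c.ι.app j).app s ≫ c.pt.map h = (D.obj j).map h ≫ (c.ι.app j).app t :=
      ((c.ι.app j).naturality h).symm
    have : (c.ι.app j).app s ≫ c.pt.map (f + g) =
        (c.ι.app j).app s ≫ (c.pt.map f + c.pt.map g) := by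
      rw [Preadditive.comp_add, hn, hn, hn, (D.obj j).map_add, Preadditive.add_comp]
    exact this

section

variable {J : Type w} [SmallCategory J] [IsFiltered J] {D : J ⥤ Sᵒᵖ ⥤ AddCommGrpCat.{w}}
  {c : Cocone D} (hc : IsColimit c) (hD : ∀ j, (D.obj j).Additive)

include hc hD

/-- By Yoneda, morphisms from a representable are elements of a value, and evaluation to underlying
sets commutes with filtered colimits; the next lemma is the injectivity half. -/
lemma exists_hom_preadditiveYoneda (s : S) (x : preadditiveYoneda.obj s ⟶ c.pt) :
    ∃ (j : J) (z : preadditiveYoneda.obj s ⟶ D.obj j), z ≫ c.ι.app j = x := by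
  have := additive_of_isColimit hc hD
  let hc' := isColimitOfPreserves ((evaluation _ _).obj (op s) ⋙ forget _) hc
  obtain ⟨j, (z : (D.obj j).obj (op s)), hz⟩ :=
    Types.jointly_surjective _ hc' (preadditiveYonedaEquiv s _ x)
  refine ⟨j, (preadditiveYonedaEquiv s _).symm z, (preadditiveYonedaEquiv s c.pt).injective ?_⟩
  refine (preadditiveYonedaEquiv_comp _ (show D.obj j ⟶ c.pt from c.ι.app j)).trans ?_
  rw [Equiv.apply_symm_apply]
  exact hz

lemma exists_eq_preadditiveYoneda (s : S) (j : J) (x y : preadditiveYoneda.obj s ⟶ D.obj j)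
    (h : x ≫ c.ι.app j = y ≫ c.ι.app j) : ∃ (j' : J) (φ : j ⟶ j'), x ≫ D.map φ = y ≫ D.map φ := by
  have := additive_of_isColimit hc hD
  let hc' := isColimitOfPreserves ((evaluation _ _).obj (op s) ⋙ forget _) hc
  replace h := congr(preadditiveYonedaEquiv s c.pt $h)
  obtain ⟨j', φ, hφ⟩ := (Types.FilteredColimit.isColimit_eq_iff' hc' (preadditiveYonedaEquiv s _ x)
    (preadditiveYonedaEquiv s _ y)).1 h
  exact ⟨j', φ, (preadditiveYonedaEquiv s _).injective hφ⟩

end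

/-- Filteredness allows a check on underlying sets. Each element is hit by the morphism it
classifies, and two elements with the same image define parallel morphisms over `X`, which get
coequalized. -/
lemma nonempty_isColimit_canonicalCocone_preadditiveYoneda (X : Sᵒᵖ ⥤ AddCommGrpCat.{w})
    [X.Additive] [IsFiltered (CostructuredArrow preadditiveYoneda X)] :
    Nonempty (IsColimit (canonicalCocone preadditiveYoneda X)) := by
  have : ReflectsColimitsOfShape (CostructuredArrow preadditiveYoneda X)
    (forget AddCommGrpCat.{w}) := reflectsColimitsOfShape_of_reflectsIsomorphisms
  refine ⟨evaluationJointlyReflectsColimits _ fun s ↦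
    isColimitOfReflects (forget AddCommGrpCat.{w}) (Types.FilteredColimit.isColimitOf' _ _ ?_ ?_)⟩
  · intro (x : X.obj s)
    refine ⟨CostructuredArrow.mk ((preadditiveYonedaEquiv s.unop X).symm x), 𝟙 s.unop, ?_⟩
    exact ((preadditiveYonedaEquiv s.unop X).apply_symm_apply x).symm
  · intro f (x : s.unop ⟶ f.left) (y : s.unop ⟶ f.left)
      (h : (f.hom.app s).hom x = (f.hom.app s).hom y)
    let a : CostructuredArrow.mk (preadditiveYoneda.map x ≫ f.hom) ⟶ f :=
      CostructuredArrow.homMk x rfl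
    let b : CostructuredArrow.mk (preadditiveYoneda.map x ≫ f.hom) ⟶ f :=
      CostructuredArrow.homMk y ((preadditiveYonedaEquiv s.unop X).injective (by
        have h₁ : (f.hom.app s).hom (𝟙 s.unop ≫ x) = (f.hom.app s).hom (𝟙 s.unop ≫ y) := by
          rw [Category.id_comp, Category.id_comp, h]
        exact h₁.symm))
    exact ⟨_, IsFiltered.coeqHom a b,
      congr_arg CommaMorphism.left (IsFiltered.coeq_condition a b)⟩

end

section

open Opposite

variable {S : Type w} [SmallCategory S] [Preadditive S] (κ : Cardinal.{w}) [Fact κ.IsRegular]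

lemma additive_of_iso {C D : Type*} [Category* C] [Category* D] [Preadditive C] [Preadditive D]
    {F G : C ⥤ D} [F.Additive] (e : F ≅ G) : G.Additive where
  map_add {X Y f g} := by
    rw [← cancel_epi (e.hom.app X), Preadditive.comp_add, ← e.hom.naturality, ← e.hom.naturality,
      ← e.hom.naturality, F.map_add, Preadditive.add_comp]

lemma isCardinalFiltered_costructuredArrow_preadditiveYoneda {X : Sᵒᵖ ⥤ AddCommGrpCat.{w}}
    (hX : preadditiveYoneda.essImage X) :
    IsCardinalFiltered (CostructuredArrow preadditiveYoneda X) κ := by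
  obtain ⟨s, ⟨e⟩⟩ := hX
  have := (CostructuredArrow.mkIdTerminal (S := preadditiveYoneda) (Y := s)).isCardinalFiltered κ
  exact .of_equivalence κ (CostructuredArrow.mapIso e)

variable {κ}

lemma additive_and_isCardinalFiltered_of_isColimit {J : Type w} [SmallCategory J]
    [IsCardinalFiltered J κ] {D : J ⥤ Sᵒᵖ ⥤ AddCommGrpCat.{w}} {c : Cocone D} (hc : IsColimit c)
    (hD : ∀ j, (D.obj j).Additive)
    (hD' : ∀ j, IsCardinalFiltered (CostructuredArrow preadditiveYoneda (D.obj j)) κ) :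
    c.pt.Additive ∧ IsCardinalFiltered (CostructuredArrow preadditiveYoneda c.pt) κ := by
  have := isFiltered_of_isCardinalFiltered J κ
  exact ⟨additive_of_isColimit hc hD, isCardinalFiltered_costructuredArrow_of_cocone _ κ c
    (exists_hom_preadditiveYoneda hc hD) (exists_eq_preadditiveYoneda hc hD) hD'⟩

/-- This intrinsic description makes closure under `κ`-filtered colimits and biproducts provable
without merging presentations. -/
lemma mem_directedColimits_iff (X : Sᵒᵖ ⥤ AddCommGrpCat.{w}) :
    directedColimits (preadditiveYoneda (C := S)).essImage κ X ↔
      X.Additive ∧ IsCardinalFiltered (CostructuredArrow preadditiveYoneda X) κ := by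
  refine ⟨?_, fun ⟨_, _⟩ ↦ ?_⟩
  · rintro ⟨J, _, _, ⟨p⟩⟩
    exact additive_and_isCardinalFiltered_of_isColimit p.isColimit
      (fun j ↦ by
        obtain ⟨s, ⟨e⟩⟩ := p.prop_diag_obj j
        exact additive_of_iso e)
      (fun j ↦ isCardinalFiltered_costructuredArrow_preadditiveYoneda κ (p.prop_diag_obj j))
  · have := isFiltered_of_isCardinalFiltered (CostructuredArrow preadditiveYoneda X) κ
    obtain ⟨h⟩ := nonempty_isColimit_canonicalCocone_preadditiveYoneda X
    exact ⟨CostructuredArrow preadditiveYoneda X, inferInstance, inferInstance,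
      ⟨{ diag := _, ι := _, isColimit := h
         prop_diag_obj := fun f ↦ preadditiveYoneda.obj_mem_essImage f.left }⟩⟩

instance isClosedUnderColimitsOfShape_directedColimits (J : Type w) [SmallCategory J]
    [IsCardinalFiltered J κ] :
    (directedColimits (preadditiveYoneda (C := S)).essImage κ).IsClosedUnderColimitsOfShape J where
  colimitsOfShape_le := by
    rintro X ⟨p⟩
    exact (mem_directedColimits_iff _).2 (additive_and_isCardinalFiltered_of_isColimit p.isColimit
      (fun j ↦ ((mem_directedColimits_iff _).1 (p.prop_diag_obj j)).1)
      (fun j ↦ ((mem_directedColimits_iff _).1 (p.prop_diag_obj j)).2))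

variable (S κ)

namespace CardinalInd

instance : HasCardinalFilteredColimits (CardinalInd S κ) κ where
  hasColimitsOfShape _ _ _ := inferInstance

instance : (CardinalInd.yoneda S κ).Full :=
  inferInstanceAs (ObjectProperty.lift _ preadditiveYoneda _).Full

instance : (CardinalInd.yoneda S κ).Faithful :=
  inferInstanceAs (ObjectProperty.lift _ preadditiveYoneda _).Faithful

instance (X : CardinalInd S κ) : X.obj.Additive := ((mem_directedColimits_iff _).1 X.property).1

instance (X : CardinalInd S κ) :
    IsCardinalFiltered (CostructuredArrow preadditiveYoneda X.obj) κ :=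
  ((mem_directedColimits_iff _).1 X.property).2

/-- Morphisms out of the object are the evaluation at `s`, and `κ`-filtered colimits of ind-objects
are computed among presheaves. -/
instance isCardinalPresentable_yoneda_obj (s : S) :
    IsCardinalPresentable ((CardinalInd.yoneda S κ).obj s) κ where
  preservesColimitOfShape J _ _ := by
    have := isFiltered_of_isCardinalFiltered J κ
    let e : coyoneda.obj (op ((CardinalInd.yoneda S κ).obj s)) ≅
        (directedColimits (preadditiveYoneda (C := S)).essImage κ).ι ⋙
          (evaluation _ _).obj (op s) ⋙ forget AddCommGrpCat.{w} :=
      NatIso.ofComponents (fun X ↦ Equiv.toIso (show _ ≃ X.obj.obj (op s) from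
        InducedCategory.homEquiv.trans (preadditiveYonedaEquiv s X.obj))) (fun f ↦ rfl)
    exact preservesColimitsOfShape_of_natIso e.symm

lemma isCardinalFilteredGenerator :
    (CardinalInd.yoneda S κ).essImage.IsCardinalFilteredGenerator κ where
  le_isCardinalPresentable := by
    rintro X ⟨s, ⟨e⟩⟩
    exact (isCardinalPresentable _ κ).prop_of_iso e (isCardinalPresentable_yoneda_obj S κ s)
  exists_colimitsOfShape X := by
    have := isFiltered_of_isCardinalFiltered (CostructuredArrow preadditiveYoneda X.obj) κ
    obtain ⟨h⟩ := nonempty_isColimit_canonicalCocone_preadditiveYoneda X.obj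
    let c : Cocone (CostructuredArrow.proj preadditiveYoneda X.obj ⋙ CardinalInd.yoneda S κ) :=
      { pt := X
        ι :=
          { app f := ObjectProperty.homMk f.hom
            naturality f g φ := ObjectProperty.hom_ext _
              ((CostructuredArrow.w φ).trans (Category.comp_id _).symm) } }
    have hc : IsColimit c :=
      isColimitOfReflects (directedColimits (preadditiveYoneda (C := S)).essImage κ).ι h
    exact ⟨CostructuredArrow preadditiveYoneda X.obj, inferInstance, inferInstance,
      ⟨{ diag := _, ι := _, isColimit := hc
         prop_diag_obj := fun f ↦ (CardinalInd.yoneda S κ).obj_mem_essImage f.left }⟩⟩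

instance : IsCardinalAccessibleCategory (CardinalInd S κ) κ where
  toHasCardinalFilteredGenerator :=
    { exists_generator := ⟨.ofObj (CardinalInd.yoneda S κ).obj, inferInstance,
        (isCardinalFilteredGenerator S κ).of_le_isoClosure
          (by
            rintro X ⟨s, ⟨e⟩⟩
            exact ⟨_, .mk s, ⟨e.symm⟩⟩)
          (by
            rintro _ ⟨s⟩
            exact isCardinalPresentable_yoneda_obj S κ s)⟩ }

variable [HasFiniteBiproducts S]

/-- Cocones found over `X` and over `Y` separately combine: the biproduct in `S` of their vertices
maps componentwise to `X ⊞ Y`. -/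
lemma isCardinalFiltered_costructuredArrow_biprod (X Y : Sᵒᵖ ⥤ AddCommGrpCat.{w})
    [IsCardinalFiltered (CostructuredArrow preadditiveYoneda X) κ]
    [IsCardinalFiltered (CostructuredArrow preadditiveYoneda Y) κ] :
    IsCardinalFiltered (CostructuredArrow preadditiveYoneda (X ⊞ Y)) κ where
  nonempty_cocone {B _} K hB := by
    have := hasBinaryBiproducts_of_finite_biproducts S
    let c₁ := IsCardinalFiltered.cocone (K ⋙ CostructuredArrow.map biprod.fst) hB
    let c₂ := IsCardinalFiltered.cocone (K ⋙ CostructuredArrow.map biprod.snd) hB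
    have h₁ (b : B) : preadditiveYoneda.map (c₁.ι.app b).left ≫ c₁.pt.hom =
        (K.obj b).hom ≫ biprod.fst := CostructuredArrow.w (c₁.ι.app b)
    have h₂ (b : B) : preadditiveYoneda.map (c₂.ι.app b).left ≫ c₂.pt.hom =
        (K.obj b).hom ≫ biprod.snd := CostructuredArrow.w (c₂.ι.app b)
    let l₁ (b : B) : (K.obj b).left ⟶ c₁.pt.left := (c₁.ι.app b).left
    let l₂ (b : B) : (K.obj b).left ⟶ c₂.pt.left := (c₂.ι.app b).left
    have hl₁ {b b' : B} (φ : b ⟶ b') : (K.map φ).left ≫ l₁ b' = l₁ b :=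
      congr_arg CommaMorphism.left (c₁.w φ)
    have hl₂ {b b' : B} (φ : b ⟶ b') : (K.map φ).left ≫ l₂ b' = l₂ b :=
      congr_arg CommaMorphism.left (c₂.w φ)
    exact ⟨
      { pt := CostructuredArrow.mk (Y := c₁.pt.left ⊞ c₂.pt.left)
          (biprod.lift (preadditiveYoneda.map biprod.fst ≫ c₁.pt.hom)
            (preadditiveYoneda.map biprod.snd ≫ c₂.pt.hom))
        ι :=
          { app b := CostructuredArrow.homMk (biprod.lift (l₁ b) (l₂ b)) (by
              dsimp
              apply biprod.hom_ext
              · rw [Category.assoc, biprod.lift_fst, ← Functor.map_comp_assoc, biprod.lift_fst]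
                exact h₁ b
              · rw [Category.assoc, biprod.lift_snd, ← Functor.map_comp_assoc, biprod.lift_snd]
                exact h₂ b)
            naturality b b' φ := by
              ext
              refine Eq.trans ?_ (Category.comp_id _).symm
              refine biprod.hom_ext _ _ ?_ ?_
              · exact (Category.assoc _ _ _).trans ((congrArg _ (biprod.lift_fst _ _)).trans
                  ((hl₁ φ).trans (biprod.lift_fst _ _).symm))
              · exact (Category.assoc _ _ _).trans ((congrArg _ (biprod.lift_snd _ _)).trans
                  ((hl₂ φ).trans (biprod.lift_snd _ _).symm)) } }⟩

lemma directedColimits_biprod (X Y : CardinalInd S κ) :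
    directedColimits (preadditiveYoneda (C := S)).essImage κ (X.obj ⊞ Y.obj) := by
  refine (mem_directedColimits_iff _).2 ⟨?_, isCardinalFiltered_costructuredArrow_biprod S κ _ _⟩
  refine additive_of_isColimit (BinaryBiproduct.isColimit X.obj Y.obj) ?_
  rintro ⟨_ | _⟩
  · exact inferInstanceAs X.obj.Additive
  · exact inferInstanceAs Y.obj.Additive

instance : HasBinaryBiproducts (CardinalInd S κ) where
  has_binary_biproduct X Y :=
    hasBinaryBiproduct_of_total
      { pt := ⟨X.obj ⊞ Y.obj, directedColimits_biprod S κ X Y⟩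
        fst := ObjectProperty.homMk biprod.fst
        snd := ObjectProperty.homMk biprod.snd
        inl := ObjectProperty.homMk biprod.inl
        inr := ObjectProperty.homMk biprod.inr
        inl_fst := ObjectProperty.hom_ext _ biprod.inl_fst
        inl_snd := ObjectProperty.hom_ext _ biprod.inl_snd
        inr_fst := ObjectProperty.hom_ext _ biprod.inr_fst
        inr_snd := ObjectProperty.hom_ext _ biprod.inr_snd }
      (ObjectProperty.hom_ext _ biprod.total)

instance : HasZeroObject (CardinalInd S κ) :=
  ⟨_, (CardinalInd.yoneda S κ).map_isZero (isZero_zero S)⟩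

instance : HasFiniteBiproducts (CardinalInd S κ) :=
  have : HasFiniteCoproducts (CardinalInd S κ) := hasFiniteCoproducts_of_has_binary_and_initial
  HasFiniteBiproducts.of_hasFiniteCoproducts

end CardinalInd

end

theorem theorem2p9 (κ : Cardinal.{w}) [Fact κ.IsRegular] :
    (∀ (A : Type u) [Category.{w} A] [Preadditive A] [HasFiniteBiproducts A]
        [IsCardinalAccessibleCategory A κ],
      (∀ F : QuillenExactStructure A, F.IsLocallyCoherent κ →
        F.IsExtensionClosed (isCardinalPresentable A κ)) ∧
      ∃ e : QuillenExactStructure (Presentables A κ) ≃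
          {F : QuillenExactStructure A // F.IsLocallyCoherent κ},
        (∀ (E : QuillenExactStructure (Presentables A κ)) (T : ShortComplex A),
          (e E).1.shortExact T ↔
            directedColimits (E.shortExact.map (Presentables.incl A κ).mapShortComplex) κ T) ∧
        (∀ (F : {F : QuillenExactStructure A // F.IsLocallyCoherent κ})
            (T : ShortComplex (Presentables A κ)),
          (e.symm F).shortExact T ↔ F.1.shortExact (T.map (Presentables.incl A κ)))) ∧
    (∀ (S : Type w) [SmallCategory S] [Preadditive S] [HasFiniteBiproducts S]
        (E : QuillenExactStructure S),
      IsCardinalAccessibleCategory (CardinalInd S κ) κ ∧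
      HasFiniteBiproducts (CardinalInd S κ) ∧
      ∃! F : QuillenExactStructure (CardinalInd S κ),
        F.IsLocallyCoherent κ ∧
        F.IsExtensionClosed (CardinalInd.yoneda S κ).essImage ∧
        ∀ T : ShortComplex S,
          E.shortExact T ↔ F.shortExact (T.map (CardinalInd.yoneda S κ))) := by
  refine ⟨fun A _ _ _ _ ↦ ⟨fun F hF ↦ ?_, exists_equiv_isLocallyCoherent A κ⟩,
    fun S _ _ _ E ↦ ⟨inferInstance, inferInstance, ?_⟩⟩
  · have := hasBinaryBiproducts_of_finite_biproducts A
    exact hF.isExtensionClosed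
  · have := hasBinaryBiproducts_of_finite_biproducts S
    have hi := CardinalInd.isCardinalFilteredGenerator S κ
    exact ⟨hi.exactStructure E, ⟨hi.isLocallyCoherent_exactStructure E,
      hi.isExtensionClosed_exactStructure E, fun T ↦ (hi.locallyExact_map_iff T).symm⟩,
      fun F ⟨h₁, h₂, h₃⟩ ↦ hi.eq_exactStructure h₁ h₂ h₃⟩
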